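/- Let $L$ be a relational language, $r\in\mathbb N_0$, and let all structures be of arbitrary cardinality. A base structure is a structure $A$ in the language $L$ extended by an $r$-ary relation symbol $R$; a gadget is a structure $G$ in the language $L$ extended by constants $z_1,\dots,z_r$ whose realizations (the roots) are pairwise distinct. The $L$-structure $A*G$ has the vertex set $\big(V(A)\cup (R^A\times V(G))\big)/{\sim}$, where $\sim$ is the equivalence generated by $e_i\sim(e,z_i^G)$ for $e\in R^A$, $i\in[r]$; for $S\in L$ its $S$-edges are the tuples $([a_1],\dots,[a_s])$ with $(a_1,\dots,a_s)\in S^A$ and the tuples $([(e,v_1)],\dots,[(e,v_s)])$ with $e\in R^A$, $(v_1,\dots,v_s)\in S^G$. A sequence $(M_n)$ of structures is elementarily convergent if for every first-order sentence $\phi$ the truth value of $\phi$ in $M_n$ is eventually constant; a structure $M$ (of arbitrary cardinality) is an elementary limit of $(M_n)$, written $M=\operatorname{ellim} M_n$, if every sentence $\phi$ has the same truth value in $M$ as in $M_n$ for all large $n$. Thus elementary limits are unique up to elementary equivalence $\equiv$. For an equivalence $\sigma$ on $[r]$ with classes $X_1,\dots,X_\ell$, and $X_0=\emptyset$, let $L_\sigma$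 be the extension of $L$ by relation symbols $R_0,\dots,R_\ell$, where $R_i$ has arity $|X_i|+1$. Let $\mathrm{Gad}(\sigma)$ be the gadget (over $L_\sigma$) with vertices $z_1,\dots,z_r,x_0,\dots,x_\ell$, roots $z_1,\dots,z_r$, and whose edges are exactly one $R_i$-edge for each $0\le i\le\ell$, consisting of the vertices $z_j$, $j\in X_i$ (in increasing order), followed by $x_i$. For a base structure $A$ put $A^\sigma=A*\mathrm{Gad}(\sigma)$, an $L_\sigma$-structure. Distances and components are those of the Gaifman graph. For a sequence $(G_n)$ of gadgets, $\mathrm{Eq}((G_n))$ is the equivalence on $[r]$ in which $i$ and $j$ are related if and only if $\operatorname{dist}_{G_n}(z_i,z_j)$ is bounded by a constant for all large $n$ (that is, $\lim_n \operatorname{dist}_{G_n}(z_i,z_j)<\infty$ whenever this limit exists in $[0,\infty]$). For an $L_\sigma$-structure $B$ and a gadget $H$, call the last vertices of the $R_i$-edges of $B$ ($0\le i\le\ell$) auxiliary. The $L$-structure $B*_\sigma H$ is obtained from $B$ by removing the auxiliary vertices and replacing each $R_i$-edge $e$ with $i\ge1$ by its own copy of the union of the components of $H$ that contain a root $z_j$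 with $j\in X_i$, the roots $z_j$, $j\in X_i$, being identified with the corresponding vertices of $e$, and each $R_0$-edge by its own disjoint copy of the union of the components of $H$ that contain no root; the $S$-edges ($S\in L$) are those coming from $B$ and from the copies. **Theorem.** Let $(A_n)$ be a sequence of base structures, let $(G_n)$ be an elementarily convergent sequence of gadgets, and set $\sigma=\mathrm{Eq}((G_n))$. If the sequence $(A_n^\sigma)$ is elementarily convergent, then the sequence $(A_n*G_n)$ is elementarily convergent and $$\operatorname{ellim}(A_n*G_n)\equiv(\operatorname{ellim}A_n^\sigma)*_\sigma(\operatorname{ellim}G_n),$$ that is, for every elementary limit $B$ of $(A_n^\sigma)$ and every elementary limit $H$ of $(G_n)$, the structure $B*_\sigma H$ is an elementary limit of $(A_n*G_n)$, and hence elementarily equivalent to every elementary limit of this sequence. -/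

import Mathlib

open FirstOrder FirstOrder.Language Filter Topology

universe u v w w' w₁ w₂ w₃

/-! ### Elementary convergence -/

open Classical in
/-- The Stone pairing of a sentence with a structure: `1` if the sentence holds, `0` otherwise. -/
noncomputable def stonePairing {L : FirstOrder.Language.{u, v}} (φ : L.Sentence) (M : Type w)
    [L.Structure M] : ℝ :=
  if M ⊨ φ then 1 else 0

/-- Elementary convergence (convergence with respect to sentences): the Stone pairing with every
sentence converges. -/
def ElementarilyConvergent (L : FirstOrder.Language.{u, v}) (M : ℕ → Type w)
    [∀ n, L.Structure (M n)] : Prop :=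
  ∀ φ : L.Sentence, ∃ l : ℝ, Tendsto (fun n => stonePairing φ (M n)) atTop (𝓝 l)

/-- `N` is an elementary limit of the sequence `M`. -/
def IsElementaryLimit (L : FirstOrder.Language.{u, v}) (M : ℕ → Type w) [∀ n, L.Structure (M n)]
    (N : Type w') [L.Structure N] : Prop :=
  ∀ φ : L.Sentence, Tendsto (fun n => stonePairing φ (M n)) atTop (𝓝 (stonePairing φ N))

/-! ### The Gaifman graph -/

/-- The Gaifman graph of a structure: two distinct vertices are adjacent if they occur in a common
edge of some relation. Its extended distance `SimpleGraph.edist` is the distance of vertices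
in the structure, with value `⊤` for unreachable pairs. -/
def gaifmanGraph (L : FirstOrder.Language.{u, v}) (M : Type w) [L.Structure M] : SimpleGraph M where
  Adj x y := x ≠ y ∧ ∃ (s : ℕ) (S : L.Relations s) (a : Fin s → M),
    Structure.RelMap S a ∧ x ∈ Set.range a ∧ y ∈ Set.range a
  symm := ⟨fun _ _ ⟨h, s, S, a, ha, hx, hy⟩ => ⟨h.symm, s, S, a, ha, hy, hx⟩⟩
  loopless := ⟨fun _ h => h.1 rfl⟩

/-! ### Base structures, gadgets, gadget construction -/

/-- A base structure: a structure in the language `L` extended by one relation symbol `R` of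
arity `r`, given as an `L`-structure together with the realization of `R`. -/
structure BaseStructure (L : FirstOrder.Language.{u, v}) (r : ℕ) where
  /-- the vertex set -/
  V : Type w
  /-- the realizations of the symbols of `L` -/
  [str : L.Structure V]
  /-- the realization of `R` -/
  R : Set (Fin r → V)

/-- A gadget: a structure in the language `L` extended by `r` constants with pairwise distinct
realizations (the roots), given as an `L`-structure together with the roots. -/
structure Gadget (L : FirstOrder.Language.{u, v}) (r : ℕ) where
  /-- the vertex set -/
  V : Type w
  /-- the realizations of the symbols of `L` -/
  [str : L.Structure V]
  /-- the realizations of the constants -/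
  root : Fin r → V
  root_injective : Function.Injective root

attribute [instance] BaseStructure.str Gadget.str

/-- The realization of the constants in a gadget. Together with the `L`-structure it makes the
gadget a structure in the language `L[[Fin r]]`, which is `L` extended by `r` constants. -/
instance Gadget.constantsStructure {L : FirstOrder.Language.{u, v}} {r : ℕ}
    (G : Gadget.{u, v, w} L r) : (constantsOn (Fin r)).Structure G.V :=
  constantsOn.structure G.root

/-- The pairs generating the equivalence that identifies the vertices of an `R`-edge `e` with the
roots of the copy of the gadget replacing `e`. -/
inductive GadgetStarGlue {L : FirstOrder.Language.{u, v}} {r : ℕ} (A : BaseStructure.{u, v, w} L r)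
    (G : Gadget.{u, v, w'} L r) : A.V ⊕ (A.R × G.V) → A.V ⊕ (A.R × G.V) → Prop
  | glue (e : A.R) (i : Fin r) : GadgetStarGlue A G (Sum.inl (e.1 i)) (Sum.inr (e, G.root i))

/-- The vertex set of the gadget construction `A * G` (`Quot` is the quotient by the equivalence
generated by the given relation). -/
def GadgetStar {L : FirstOrder.Language.{u, v}} {r : ℕ} (A : BaseStructure.{u, v, w} L r)
    (G : Gadget.{u, v, w'} L r) : Type (max w w') :=
  Quot (GadgetStarGlue A G)

/-- The `L`-structure on the gadget construction `A * G`. -/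
instance GadgetStar.instStructure {L : FirstOrder.Language.{u, v}} [L.IsRelational] {r : ℕ}
    (A : BaseStructure.{u, v, w} L r) (G : Gadget.{u, v, w'} L r) : L.Structure (GadgetStar A G) where
  funMap f := isEmptyElim f
  RelMap {s} S x :=
    (∃ a : Fin s → A.V, Structure.RelMap S a ∧ x = fun i => Quot.mk _ (Sum.inl (a i))) ∨
    (∃ (e : A.R) (b : Fin s → G.V), Structure.RelMap S b ∧
      x = fun i => Quot.mk _ (Sum.inr (e, b i)))

/-! ### Fragmentation -/

open Classical in
/-- The classes of an equivalence on the index set, including the additional class `X₀ = ∅`,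
which is represented by `none`. -/
noncomputable def classOf {r : ℕ} (σ : Setoid (Fin r)) : Option (Quotient σ) → Finset (Fin r)
  | none => ∅
  | some q => Finset.univ.filter fun i => (Quotient.mk σ i) = q

/-- The indices from the class `X` in increasing order. -/
noncomputable def classEnum {r : ℕ} (σ : Setoid (Fin r)) (X : Option (Quotient σ)) :
    Fin (classOf σ X).card → Fin r :=
  (classOf σ X).orderEmbOfFin rfl

/-- The symbols added to `L` in the language of fragmented base structures: for every class `X`
(including the empty one) a relation symbol of arity `|X| + 1`. -/
inductive FragRel {r : ℕ} (σ : Setoid (Fin r)) : ℕ → Type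
  | sub (X : Option (Quotient σ)) : FragRel σ ((classOf σ X).card + 1)

/-- The language consisting of the symbols `FragRel σ`. -/
def fragSymbols {r : ℕ} (σ : Setoid (Fin r)) : FirstOrder.Language.{0, 0} where
  Functions _ := Empty
  Relations := FragRel σ

instance fragSymbols.instIsRelational {r : ℕ} (σ : Setoid (Fin r)) :
    (fragSymbols σ).IsRelational :=
  fun _ => inferInstanceAs (IsEmpty Empty)

/-- The language `L_σ` of fragmented base structures. -/
abbrev fragLanguage (L : FirstOrder.Language.{u, v}) {r : ℕ} (σ : Setoid (Fin r)) :
    FirstOrder.Language.{u, v} :=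
  L.sum (fragSymbols σ)

/-- A base structure over `L` viewed as a base structure over the larger language `L_σ` with empty
realizations of the additional symbols. -/
def BaseStructure.toFragLanguage {L : FirstOrder.Language.{u, v}} [L.IsRelational] {r : ℕ}
    (A : BaseStructure.{u, v, w} L r) (σ : Setoid (Fin r)) :
    BaseStructure.{u, v, w} (fragLanguage L σ) r where
  V := A.V
  str :=
    { funMap := fun f => isEmptyElim f
      RelMap := fun {_} S x =>
        match S with
        | Sum.inl S => Structure.RelMap S x
        | Sum.inr _ => False }
  R := A.R

/-- The `L_σ`-edges of the canonical gadget: exactly one edge for each symbol of `FragRel σ`, spanning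
the roots with index in the class `X` and the auxiliary vertex of `X` (the last one), and no edges
for the symbols of `L`. -/
def gadRel {r : ℕ} (σ : Setoid (Fin r)) : {s : ℕ} → FragRel σ s →
    (Fin s → Fin r ⊕ Option (Quotient σ)) → Prop
  | _, FragRel.sub X, x =>
    x = Fin.snoc (α := fun _ => Fin r ⊕ Option (Quotient σ))
      (fun j => Sum.inl (classEnum σ X j)) (Sum.inr X)

/-- The canonical gadget `Gad(σ)`. The vertices are the roots and one auxiliary vertex for each
class of `σ` (including the empty one). -/
def Gad (L : FirstOrder.Language.{u, v}) [L.IsRelational] {r : ℕ} (σ : Setoid (Fin r)) :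
    Gadget.{u, v, 0} (fragLanguage L σ) r where
  V := Fin r ⊕ Option (Quotient σ)
  str :=
    { funMap := fun f => isEmptyElim f
      RelMap := fun {_} S x =>
        match S with
        | Sum.inl _ => False
        | Sum.inr S => gadRel σ S x }
  root := Sum.inl
  root_injective := Sum.inl_injective

/-- The fragmented base structure `A^σ = A * Gad(σ)`; it is an `L_σ`-structure. -/
abbrev Fragmented {L : FirstOrder.Language.{u, v}} [L.IsRelational] {r : ℕ}
    (A : BaseStructure.{u, v, w} L r) (σ : Setoid (Fin r)) : Type w :=
  GadgetStar (A.toFragLanguage σ) (Gad L σ)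

/-! ### The canonical equivalence of a sequence of gadgets -/

/-- The equivalence `Eq(G)` on the root indices of a sequence of gadgets: two indices are related if
the distances of the corresponding roots stay bounded, i.e. if their limit is finite. -/
def gadgetEq {L : FirstOrder.Language.{u, v}} {r : ℕ} (G : ℕ → Gadget.{u, v, w} L r) :
    Setoid (Fin r) where
  r i j := ∃ d : ℕ, ∀ᶠ n in atTop,
    (gaifmanGraph L (G n).V).edist ((G n).root i) ((G n).root j) ≤ d
  iseqv :=
    { refl := fun i => ⟨0, Eventually.of_forall fun n => by simp⟩
      symm := fun ⟨d, h⟩ => ⟨d, h.mono fun n hn => by rwa [SimpleGraph.edist_comm]⟩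
      trans := fun ⟨d, h⟩ ⟨d', h'⟩ => ⟨d + d', (h.and h').mono fun n hn =>
        SimpleGraph.edist_triangle.trans (by push_cast; exact add_le_add hn.1 hn.2)⟩ }

/-! ### Gadget construction for fragmented base structures -/

/-- The subedges of the class `X` in an `L_σ`-structure. -/
def subedges (L : FirstOrder.Language.{u, v}) {r : ℕ} (σ : Setoid (Fin r)) (B : Type w)
    [(fragLanguage L σ).Structure B] (X : Option (Quotient σ)) :
    Set (Fin ((classOf σ X).card + 1) → B) :=
  {e | Structure.RelMap (L := fragLanguage L σ) (Sum.inr (FragRel.sub X)) e}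

/-- The auxiliary vertices of an `L_σ`-structure: the last vertices of subedges. -/
def IsAuxiliary (L : FirstOrder.Language.{u, v}) {r : ℕ} (σ : Setoid (Fin r)) {B : Type w}
    [(fragLanguage L σ).Structure B] (b : B) : Prop :=
  ∃ X, ∃ e ∈ subedges L σ B X, e (Fin.last _) = b

/-- The part of the gadget that replaces the subedges of the class `X`: for the empty class, the union
of the components that contain no root; for a nonempty class, the component (the union of the
components, should there be more of them) that contains the roots with index in the class. -/
def Gadget.piece {L : FirstOrder.Language.{u, v}} {r : ℕ} (H : Gadget.{u, v, w} L r)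
    (σ : Setoid (Fin r)) : Option (Quotient σ) → Set H.V
  | none => {h | ∀ i, ¬ (gaifmanGraph L H.V).Reachable (H.root i) h}
  | some q => {h | ∃ i, Quotient.mk σ i = q ∧ (gaifmanGraph L H.V).Reachable (H.root i) h}

/-- The vertices of the construction `*_σ` before identification: the non-auxiliary vertices of `B`
and, for each subedge of each class `X`, a copy of the corresponding part of `H`. -/
abbrev PreFragStar {L : FirstOrder.Language.{u, v}} {r : ℕ} (σ : Setoid (Fin r)) (B : Type w)
    [(fragLanguage L σ).Structure B] (H : Gadget.{u, v, w'} L r) : Type (max w w') :=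
  {b : B // ¬ IsAuxiliary L σ b} ⊕ (Σ X, subedges L σ B X × H.piece σ X)

/-- The pairs generating the equivalence that identifies the non-auxiliary vertices of a subedge
with the roots in the copy of the part of `H` that replaces the subedge. -/
inductive FragStarGlue {L : FirstOrder.Language.{u, v}} {r : ℕ} (σ : Setoid (Fin r)) (B : Type w)
    [(fragLanguage L σ).Structure B] (H : Gadget.{u, v, w'} L r) :
    PreFragStar σ B H → PreFragStar σ B H → Prop
  | glue (X : Option (Quotient σ)) (e : subedges L σ B X) (j : Fin (classOf σ X).card)
      (b : {b : B // ¬ IsAuxiliary L σ b}) (h : H.piece σ X)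
      (hb : b.1 = e.1 j.castSucc) (hh : h.1 = H.root (classEnum σ X j)) :
      FragStarGlue σ B H (Sum.inl b) (Sum.inr ⟨X, e, h⟩)

/-- The vertex set of the modified gadget construction `B *_σ H`. -/
def FragStar {L : FirstOrder.Language.{u, v}} {r : ℕ} (σ : Setoid (Fin r)) (B : Type w)
    [(fragLanguage L σ).Structure B] (H : Gadget.{u, v, w'} L r) : Type (max w w') :=
  Quot (FragStarGlue σ B H)

/-- The `L`-structure on `B *_σ H`. -/
instance FragStar.instStructure {L : FirstOrder.Language.{u, v}} [L.IsRelational] {r : ℕ}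
    (σ : Setoid (Fin r)) (B : Type w) [(fragLanguage L σ).Structure B]
    (H : Gadget.{u, v, w'} L r) : L.Structure (FragStar σ B H) where
  funMap f := isEmptyElim f
  RelMap {s} S x :=
    (∃ a : Fin s → {b : B // ¬ IsAuxiliary L σ b},
      Structure.RelMap (L := fragLanguage L σ) (Sum.inl S) (fun i => (a i).1) ∧
      x = fun i => Quot.mk _ (Sum.inl (a i))) ∨
    (∃ (X : Option (Quotient σ)) (e : subedges L σ B X) (h : Fin s → H.piece σ X),
      Structure.RelMap S (fun i => (h i).1) ∧
      x = fun i => Quot.mk _ (Sum.inr ⟨X, e, h i⟩))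

universe u₁

/-! ### Back-and-forth systems for a set of relation symbols -/

section BackForth

/-! A sentence uses only a finite set `T` of symbols, so an infinite Ehrenfeucht–Fraïssé game over
`T` decides whether two structures agree on it. Suppose a sentence has another value in `B *_σ H`
than in infinitely many `A_n * G_n`. Compare an ultraproduct of these `A_n * G_n` with an ultrapower
of `B *_σ H`. By Łoś's theorem and countable saturation, `UProd.exists_isBackForthSystem` links the
ultraproduct of the `A_n^σ` to the ultrapower of `B`, and the ultraproduct of the `G_n` to the
ultrapower of `H`, respecting roots. The core, `PartsBackForth.isBackForthSystem`, composes these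
two games into one on the composite structures, which contradicts the disagreement.

Both composites satisfy one list of axioms, `IsDecomposition`, which passes to ultraproducts. In
`A_n * G_n` a copy of the gadget may well connect roots of different classes of `σ`. In the
ultraproduct of the `G_n`, however, roots joined by `T`-edges are joined by a walk of finite length.
Such a walk transfers to `H`, where connected roots are `σ`-equivalent (`gadgetEq_of_reachable`). So
in the ultraproduct every copy splits into one piece per class, with no `T`-edge between pieces,
just as in `B *_σ H`.

For the composition, vertices are of three kinds. Base vertices, including the roots of copies,
follow the base game. A rooted vertex, reached from a root by `T`-edges, lies over a subedge;
subedges are paired by the base game, and each pair carries its own gadget game. An orphan, not so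
reached, is independent of the base. Copies of orphans may therefore be matched by any injective
pairing, provided that both sides have the same number of subedges of every class, as far as finite
numbers can tell. In the ultrapower of `H` an orphan may carry the label of a nonempty class, being
connected to a root only by longer and longer walks or by symbols outside `T`. This is why a matched
copy of orphans consists of one subedge of each class. -/

/-- The family of the inverses of the partial maps of a family. -/
def swapFamily {M : Type w} {N : Type w'} (𝓕 : Set (Set (M × N))) : Set (Set (N × M)) :=
  {F | Prod.swap ⁻¹' F ∈ 𝓕}

theorem swap_mem_swapFamily {M : Type w} {N : Type w'} {𝓕 : Set (Set (M × N))}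
    {F : Set (M × N)} (hF : F ∈ 𝓕) :
    Prod.swap ⁻¹' F ∈ swapFamily 𝓕 := by
  change Prod.swap ⁻¹' (Prod.swap ⁻¹' F) ∈ 𝓕
  rwa [← Set.preimage_comp, Prod.swap_swap_eq, Set.preimage_id]

variable {L : FirstOrder.Language.{u, v}} {M : Type w} {N : Type w'} [L.Structure M] [L.Structure N]

/-- One half of a back-and-forth system: a family of finite partial maps, given by their graphs,
that preserve the symbols of `T` and equality, and extend to any element of the source. -/
structure IsForthSystem (T : Set (Σ n, L.Relations n)) (𝓕 : Set (Set (M × N))) : Prop where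
  rel : ∀ F ∈ 𝓕, ∀ {s : ℕ} (S : L.Relations s), ⟨s, S⟩ ∈ T → ∀ (x : Fin s → M) (y : Fin s → N),
    (∀ i, (x i, y i) ∈ F) → Structure.RelMap S x → Structure.RelMap S y
  eq : ∀ F ∈ 𝓕, ∀ {x x' : M} {y y' : N}, (x, y) ∈ F → (x', y') ∈ F → x = x' → y = y'
  forth : ∀ F ∈ 𝓕, ∀ x : M, ∃ F' ∈ 𝓕, F ⊆ F' ∧ ∃ y, (x, y) ∈ F'

/-- A back-and-forth system with respect to the symbols of `T`. -/
structure IsBackForthSystem (T : Set (Σ n, L.Relations n)) (𝓕 : Set (Set (M × N))) : Prop where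
  left : IsForthSystem T 𝓕
  right : IsForthSystem T (swapFamily 𝓕)

namespace IsBackForthSystem

variable {T T' : Set (Σ n, L.Relations n)} {𝓕 : Set (Set (M × N))}

theorem symm (h : IsBackForthSystem T 𝓕) : IsBackForthSystem T (swapFamily 𝓕) :=
  ⟨h.right, h.left⟩

theorem eq_iff (h : IsBackForthSystem T 𝓕) {F : Set (M × N)} (hF : F ∈ 𝓕) {x x' : M} {y y' : N}
    (h₁ : (x, y) ∈ F) (h₂ : (x', y') ∈ F) : x = x' ↔ y = y' :=
  ⟨h.left.eq F hF h₁ h₂, h.right.eq _ (swap_mem_swapFamily hF) h₁ h₂⟩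

theorem rel_iff (h : IsBackForthSystem T 𝓕) {F : Set (M × N)} (hF : F ∈ 𝓕) {s : ℕ}
    {S : L.Relations s} (hS : ⟨s, S⟩ ∈ T) {x : Fin s → M} {y : Fin s → N}
    (hxy : ∀ i, (x i, y i) ∈ F) : Structure.RelMap S x ↔ Structure.RelMap S y :=
  ⟨h.left.rel F hF S hS x y hxy, h.right.rel _ (swap_mem_swapFamily hF) S hS y x hxy⟩

theorem back (h : IsBackForthSystem T 𝓕) {F : Set (M × N)} (hF : F ∈ 𝓕) (y : N) :
    ∃ F' ∈ 𝓕, F ⊆ F' ∧ ∃ x, (x, y) ∈ F' := by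
  obtain ⟨F', hF', hsub, x, hx⟩ := h.right.forth _ (swap_mem_swapFamily hF) y
  exact ⟨_, hF', fun p hp => hsub (a := p.swap) hp, x, hx⟩

theorem mono (h : IsBackForthSystem T 𝓕) (hT : T' ⊆ T) : IsBackForthSystem T' 𝓕 :=
  ⟨⟨fun F hF _ S hS => h.left.rel F hF S (hT hS), h.left.eq, h.left.forth⟩,
    ⟨fun F hF _ S hS => h.right.rel F hF S (hT hS), h.right.eq, h.right.forth⟩⟩

end IsBackForthSystem

theorem IsForthSystem.forth_tuple {T : Set (Σ n, L.Relations n)} {𝓕 : Set (Set (M × N))}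
    (h : IsForthSystem T 𝓕) {F : Set (M × N)} (hF : F ∈ 𝓕) {k : ℕ} (x : Fin k → M) :
    ∃ F' ∈ 𝓕, F ⊆ F' ∧ ∃ y : Fin k → N, ∀ i, (x i, y i) ∈ F' := by
  induction k with
  | zero => exact ⟨F, hF, subset_rfl, Fin.elim0, fun i => i.elim0⟩
  | succ k ih =>
    obtain ⟨F₁, hF₁, h₁, y, hy⟩ := ih (Fin.init x)
    obtain ⟨F₂, hF₂, h₂, z, hz⟩ := h.forth F₁ hF₁ (x (Fin.last k))
    refine ⟨F₂, hF₂, h₁.trans h₂, Fin.snoc y z, fun i => ?_⟩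
    induction i using Fin.lastCases with
    | last => simpa using hz
    | cast i => simpa [Fin.init] using h₂ (hy i)

theorem realize_term_of_isRelational [L.IsRelational] {α : Type*} (t : L.Term α) :
    ∃ a : α, t = Term.var a := by
  cases t with
  | var a => exact ⟨a, rfl⟩
  | func f _ => exact isEmptyElim f

/-- A formula contains finitely many symbols, and its truth value is preserved by back-and-forth
systems with respect to these symbols. -/
theorem exists_finite_realize_iff [L.IsRelational] {k : ℕ} (φ : L.BoundedFormula Empty k) :
    ∃ T : Set (Σ n, L.Relations n), T.Finite ∧
      ∀ (M : Type w) (N : Type w') [L.Structure M] [L.Structure N] (𝓕 : Set (Set (M × N))),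
        IsBackForthSystem T 𝓕 → ∀ F ∈ 𝓕, ∀ (x : Fin k → M) (y : Fin k → N),
          (∀ i, (x i, y i) ∈ F) → (φ.Realize default x ↔ φ.Realize default y) := by
  induction φ with
  | falsum => exact ⟨∅, Set.finite_empty, fun M N _ _ 𝓕 _ F _ x y _ => Iff.rfl⟩
  | equal t₁ t₂ =>
    refine ⟨∅, Set.finite_empty, fun M N _ _ 𝓕 h F hF x y hxy => ?_⟩
    obtain ⟨a, rfl⟩ := realize_term_of_isRelational t₁
    obtain ⟨b, rfl⟩ := realize_term_of_isRelational t₂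
    rcases a with a | a
    · exact a.elim
    rcases b with b | b
    · exact b.elim
    exact h.eq_iff hF (hxy a) (hxy b)
  | @rel k l R ts =>
    refine ⟨{⟨l, R⟩}, Set.finite_singleton _, fun M N _ _ 𝓕 h F hF x y hxy => ?_⟩
    refine h.rel_iff hF (Set.mem_singleton _) fun i => ?_
    obtain ⟨a, ha⟩ := realize_term_of_isRelational (ts i)
    rw [ha]
    rcases a with a | a
    · exact a.elim
    exact hxy a
  | imp f₁ f₂ ih₁ ih₂ =>
    obtain ⟨T₁, hT₁, h₁⟩ := ih₁
    obtain ⟨T₂, hT₂, h₂⟩ := ih₂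
    refine ⟨T₁ ∪ T₂, hT₁.union hT₂, fun M N _ _ 𝓕 h F hF x y hxy => ?_⟩
    exact imp_congr (h₁ M N 𝓕 (h.mono Set.subset_union_left) F hF x y hxy)
      (h₂ M N 𝓕 (h.mono Set.subset_union_right) F hF x y hxy)
  | all f ih =>
    obtain ⟨T, hT, h⟩ := ih
    refine ⟨T, hT, fun M N _ _ 𝓕 hb F hF x y hxy => ?_⟩
    have key : ∀ F' ∈ 𝓕, F ⊆ F' → ∀ a b, (a, b) ∈ F' →
        (f.Realize default (Fin.snoc x a) ↔ f.Realize default (Fin.snoc y b)) := by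
      refine fun F' hF' hsub a b hab => h M N 𝓕 hb F' hF' _ _ fun i => ?_
      induction i using Fin.lastCases with
      | last => simpa using hab
      | cast i => simpa using hsub (hxy i)
    constructor
    · intro H b
      obtain ⟨F', hF', hsub, a, hab⟩ := hb.back hF b
      exact (key F' hF' hsub a b hab).1 (H a)
    · intro H a
      obtain ⟨F', hF', hsub, b, hab⟩ := hb.left.forth F hF a
      exact (key F' hF' hsub a b hab).2 (H b)

/-! ### Reachability through the edges of a set of symbols -/

/-- Two vertices occur in a common edge of a symbol of `T`. -/
def AdjOn (T : Set (Σ n, L.Relations n)) (x y : M) : Prop :=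
  ∃ (s : ℕ) (S : L.Relations s), ⟨s, S⟩ ∈ T ∧ ∃ a : Fin s → M, Structure.RelMap S a ∧
    x ∈ Set.range a ∧ y ∈ Set.range a

/-- There is a walk of length `d` through edges of symbols of `T`. -/
def WalkOn (T : Set (Σ n, L.Relations n)) : ℕ → M → M → Prop
  | 0, x, y => x = y
  | d + 1, x, y => ∃ z, AdjOn T x z ∧ WalkOn T d z y

/-- There is a walk through edges of symbols of `T`. -/
def ReachOn (T : Set (Σ n, L.Relations n)) (x y : M) : Prop := ∃ d, WalkOn T d x y

theorem AdjOn.symm {T : Set (Σ n, L.Relations n)} {x y : M} (h : AdjOn T x y) : AdjOn T y x := by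
  obtain ⟨s, S, hS, a, ha, hx, hy⟩ := h
  exact ⟨s, S, hS, a, ha, hy, hx⟩

theorem WalkOn.snoc {T : Set (Σ n, L.Relations n)} {d : ℕ} {x y z : M} (h : WalkOn T d x y)
    (h' : AdjOn T y z) : WalkOn T (d + 1) x z := by
  induction d generalizing x with
  | zero => cases h; exact ⟨z, h', rfl⟩
  | succ d ih =>
    obtain ⟨t, ht, h⟩ := h
    exact ⟨t, ht, ih h⟩

theorem ReachOn.snoc {T : Set (Σ n, L.Relations n)} {x y z : M} (h : ReachOn T x y)
    (h' : AdjOn T y z) : ReachOn T x z :=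
  let ⟨d, hd⟩ := h
  ⟨d + 1, hd.snoc h'⟩

theorem WalkOn.trans {T : Set (Σ n, L.Relations n)} {d d' : ℕ} {x y z : M} (h : WalkOn T d x y)
    (h' : WalkOn T d' y z) : ReachOn T x z := by
  induction d' generalizing y d with
  | zero => cases h'; exact ⟨d, h⟩
  | succ d' ih =>
    obtain ⟨t, ht, h'⟩ := h'
    exact ih (h.snoc ht) h'

theorem WalkOn.symm {T : Set (Σ n, L.Relations n)} {d : ℕ} {x y : M} (h : WalkOn T d x y) :
    WalkOn T d y x := by
  induction d generalizing x with
  | zero => cases h; rfl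
  | succ d ih =>
    obtain ⟨t, ht, h⟩ := h
    exact (ih h).snoc ht.symm

theorem ReachOn.symm {T : Set (Σ n, L.Relations n)} {x y : M} (h : ReachOn T x y) :
    ReachOn T y x :=
  let ⟨d, hd⟩ := h
  ⟨d, hd.symm⟩

theorem ReachOn.trans {T : Set (Σ n, L.Relations n)} {x y z : M} (h : ReachOn T x y)
    (h' : ReachOn T y z) : ReachOn T x z :=
  let ⟨_, hd⟩ := h
  let ⟨_, hd'⟩ := h'
  hd.trans hd'

theorem WalkOn.edist_le {T : Set (Σ n, L.Relations n)} {d : ℕ} {x y : M} (h : WalkOn T d x y) :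
    (gaifmanGraph L M).edist x y ≤ d := by
  induction d generalizing x with
  | zero => cases h; simp
  | succ d ih =>
    obtain ⟨z, ⟨s, S, _, a, ha, hx, hz⟩, h⟩ := h
    -- `AdjOn` is reflexive on the vertices of an edge, whereas the Gaifman graph has no loops.
    by_cases hxz : x = z
    · subst hxz
      exact (ih h).trans (by exact_mod_cast Nat.le_succ d)
    · have hadj : (gaifmanGraph L M).Adj x z := ⟨hxz, s, S, a, ha, hx, hz⟩
      refine (SimpleGraph.edist_triangle (v := z)).trans ?_
      have h1 := SimpleGraph.edist_eq_one_iff_adj.2 hadj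
      rw [h1, add_comm, Nat.cast_succ]
      gcongr
      exact ih h

theorem WalkOn.reachable {T : Set (Σ n, L.Relations n)} {d : ℕ} {x y : M} (h : WalkOn T d x y) :
    (gaifmanGraph L M).Reachable x y := by
  rw [← SimpleGraph.edist_ne_top_iff_reachable]
  exact ne_top_of_le_ne_top (ENat.natCast_ne_top d) h.edist_le

theorem WalkOn.mono {T T' : Set (Σ n, L.Relations n)} (hT : T ⊆ T') {d : ℕ} {x y : M}
    (h : WalkOn T d x y) : WalkOn T' d x y := by
  induction d generalizing x with
  | zero => exact h
  | succ d ih =>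
    obtain ⟨t, ⟨s, S, hS, ha⟩, h⟩ := h
    exact ⟨t, ⟨s, S, hT hS, ha⟩, ih h⟩

/-- A walk has finitely many steps, each witnessed by a single symbol. This brings the distance in a
possibly infinite language into the reach of games over a finite `T`. -/
theorem exists_finite_walkOn {x y : M} (h : (gaifmanGraph L M).Reachable x y) :
    ∃ T : Set (Σ n, L.Relations n), T.Finite ∧ ∃ d, WalkOn T d x y := by
  obtain ⟨p⟩ := h
  induction p with
  | nil => exact ⟨∅, Set.finite_empty, 0, rfl⟩
  | cons hadj _ ih =>
    obtain ⟨T, hT, d, hd⟩ := ih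
    obtain ⟨_, s, S, a, ha⟩ := hadj
    exact ⟨insert ⟨s, S⟩ T, hT.insert _, d + 1, _, ⟨s, S, Set.mem_insert _ _, a, ha⟩,
      hd.mono (Set.subset_insert _ _)⟩

/-- The game answers the edges of the walk one at a time, so walks transfer with their length and no
distance formula has to be written down. -/
theorem IsForthSystem.walkOn {T : Set (Σ n, L.Relations n)} {𝓕 : Set (Set (M × N))}
    (h : IsForthSystem T 𝓕) {F : Set (M × N)} (hF : F ∈ 𝓕) {x x' : M} {y y' : N}
    (hx : (x, y) ∈ F) (hx' : (x', y') ∈ F) {d : ℕ} (hd : WalkOn T d x x') : WalkOn T d y y' := by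
  induction d generalizing x y F with
  | zero => exact h.eq F hF hx hx' hd
  | succ d ih =>
    obtain ⟨z, ⟨s, S, hS, a, ha, ⟨i, rfl⟩, ⟨j, rfl⟩⟩, hd⟩ := hd
    obtain ⟨F', hF', hsub, b, hb⟩ := h.forth_tuple hF a
    refine ⟨b j, ⟨s, S, hS, b, h.rel F' hF' S hS a b hb ha, ⟨i, ?_⟩, ⟨j, rfl⟩⟩,
      ih hF' (hb j) (hsub hx') hd⟩
    exact h.eq F' hF' (hb i) (hsub hx) rfl

end BackForth

/-! ### Ultraproducts of sequences -/

/-- Either all or none of the types of the sequence are empty. -/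
class UniformlyNonempty (M : ℕ → Type w) : Prop where
  nonempty_of_nonempty : ∀ m n, Nonempty (M m) → Nonempty (M n)

instance UniformlyNonempty.const (N : Type w) : UniformlyNonempty fun _ : ℕ => N := ⟨fun _ _ h => h⟩

/-- The ultraproduct of a sequence of types. -/
abbrev UProd (U : Ultrafilter ℕ) (M : ℕ → Type w) : Type w := (U : Filter ℕ).Product M

namespace UProd

variable {L : FirstOrder.Language.{u, v}} {U : Ultrafilter ℕ} {M : ℕ → Type w}

/-- A sequence representing an element of an ultraproduct. -/
noncomputable def out (a : UProd U M) : ∀ n, M n := Quotient.out a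

/-- The element of the ultraproduct represented by a sequence. -/
def mk (f : ∀ n, M n) : UProd U M := Quotient.mk _ f

theorem out_mk (f : ∀ n, M n) : ∀ᶠ n in U, (mk f : UProd U M).out n = f n :=
  Quotient.exact (Quotient.out_eq (mk f : UProd U M))

theorem eq_iff {a b : UProd U M} : a = b ↔ ∀ᶠ n in U, a.out n = b.out n :=
  ⟨fun h => Eventually.of_forall fun n => by rw [h], fun h => Quotient.out_equiv_out.1 h⟩

theorem mk_out (a : UProd U M) : mk a.out = a := Quotient.out_eq a

theorem relMap_iff [∀ n, L.Structure (M n)] {s : ℕ} (S : L.Relations s) (x : Fin s → UProd U M) :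
    Structure.RelMap S x ↔ ∀ᶠ n in U, Structure.RelMap S fun i => (x i).out n := by
  have h : x = fun i => ((x i).out : (U : Filter ℕ).Product M) :=
    funext fun i => (mk_out (x i)).symm
  conv_lhs => rw [h]
  exact relMap_quotient_mk' (s := (U : Filter ℕ).productSetoid M)
    (ps := Ultraproduct.setoidPrestructure M U) S fun i => (x i).out

/-- Witnesses are chosen coordinatewise. On the exceptional coordinates an arbitrary default is
used; it exists because one witness makes all the types nonempty. -/
theorem exists_of_eventually [hM : UniformlyNonempty M] {Q : ∀ n, M n → Prop}
    (h : ∀ᶠ n in U, ∃ x, Q n x) : ∃ a : UProd U M, ∀ᶠ n in U, Q n (a.out n) := by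
  obtain ⟨m, x, -⟩ := h.exists
  have : ∀ n, ∃ x : M n, (∃ x, Q n x) → Q n x := by
    intro n
    by_cases hn : ∃ x, Q n x
    · exact hn.imp fun _ hx _ => hx
    · exact (hM.1 m n ⟨x⟩).elim fun y => ⟨y, fun h => (hn h).elim⟩
  choose f hf using this
  refine ⟨mk f, ?_⟩
  filter_upwards [h, out_mk f] with n hn h
  rw [h]
  exact hf n hn

theorem exists_tuple_of_eventually [hM : UniformlyNonempty M] {k : ℕ}
    {Q : ∀ n, (Fin k → M n) → Prop} (h : ∀ᶠ n in U, ∃ x, Q n x) :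
    ∃ a : Fin k → UProd U M, ∀ᶠ n in U, Q n fun i => (a i).out n := by
  -- The empty tuple gives no information on nonemptiness, but it needs no default either.
  rcases isEmpty_or_nonempty (Fin k) with hk | ⟨⟨i⟩⟩
  · refine ⟨isEmptyElim, h.mono fun n ⟨x, hx⟩ => ?_⟩
    rwa [Subsingleton.elim (fun i => _) x]
  · obtain ⟨m, x, -⟩ := h.exists
    have : ∀ n, ∃ x : Fin k → M n, (∃ x, Q n x) → Q n x := by
      intro n
      by_cases hn : ∃ x, Q n x
      · exact hn.imp fun _ hx _ => hx
      · exact (hM.1 m n ⟨x i⟩).elim fun y => ⟨fun _ => y, fun h => (hn h).elim⟩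
    choose f hf using this
    refine ⟨fun i => mk fun n => f n i, ?_⟩
    filter_upwards [h, eventually_all.2 fun i => out_mk (U := U) fun n => f n i] with n hn h
    simp only [h]
    exact hf n hn

/-- Łoś's theorem, with empty structures admitted. -/
theorem realize_iff [L.IsRelational] [∀ n, L.Structure (M n)] [UniformlyNonempty M] {k : ℕ}
    (φ : L.BoundedFormula Empty k) (x : Fin k → UProd U M) :
    φ.Realize default x ↔ ∀ᶠ n in U, φ.Realize default fun i => (x i).out n := by
  induction φ with
  | falsum => simp only [BoundedFormula.Realize, eventually_const]
  | equal t₁ t₂ =>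
    obtain ⟨a, rfl⟩ := realize_term_of_isRelational t₁
    obtain ⟨b, rfl⟩ := realize_term_of_isRelational t₂
    rcases a with a | a
    · exact a.elim
    rcases b with b | b
    · exact b.elim
    exact eq_iff
  | rel R ts =>
    choose a ha using fun i => realize_term_of_isRelational (ts i)
    obtain rfl : ts = fun i => Term.var (a i) := funext ha
    have h1 : ∀ i, ∃ j, a i = Sum.inr j := fun i => by
      rcases h : a i with b | j
      · exact b.elim
      · exact ⟨j, rfl⟩
    choose b hb using h1
    obtain rfl : a = fun i => Sum.inr (b i) := funext hb
    exact relMap_iff R fun i => x (b i)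
  | imp f₁ f₂ ih₁ ih₂ =>
    simp only [BoundedFormula.realize_imp, ih₁, ih₂, Ultrafilter.eventually_imp]
  | all f ih =>
    have snoc_out : ∀ (a : UProd U M) (n : ℕ), (fun i => ((Fin.snoc x a : _ → UProd U M) i).out n) =
        Fin.snoc (fun i => (x i).out n) (a.out n) := by
      intro a n
      funext i
      induction i using Fin.lastCases with
      | last => simp
      | cast i => simp
    simp only [BoundedFormula.realize_all, ih, snoc_out]
    constructor
    · intro h
      by_contra hc
      -- Counterexamples on a large set of coordinates are glued into one element of the
      -- ultraproduct.
      rw [← Ultrafilter.eventually_not] at hc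
      simp only [not_forall] at hc
      obtain ⟨a, ha⟩ := exists_of_eventually hc
      obtain ⟨n, hn, hn'⟩ := (ha.and (h a)).exists
      exact hn hn'
    · exact fun h a => h.mono fun n hn => hn _

/-- Ultraproducts of sequences are countably saturated. -/
theorem exists_forall_eventually_mem [hM : UniformlyNonempty M] (hU : (U : Filter ℕ) ≤ atTop)
    {D : ℕ → ∀ n, Set (M n)} (h : ∀ m, ∀ᶠ n in U, ∃ b, ∀ i ≤ m, b ∈ D i n) :
    ∃ a : UProd U M, ∀ i, ∀ᶠ n in U, a.out n ∈ D i n := by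
  classical
  obtain ⟨m, x, -⟩ := (h 0).exists
  -- Coordinate `n` meets the longest satisfiable initial segment of the demands `D 0, ..., D n`.
  -- The cap at `n` makes a longest segment exist, and each fixed demand is below the cap for almost
  -- all `n`.
  have : ∀ n, ∃ b : M n, ∀ i ≤ n, (∃ b', ∀ j ≤ i, b' ∈ D j n) → b ∈ D i n := by
    intro n
    by_cases hn : ∃ b', ∀ j ≤ 0, b' ∈ D j n
    · obtain ⟨b, hb⟩ := Nat.findGreatest_spec (P := fun m => ∃ b', ∀ j ≤ m, b' ∈ D j n)
        (Nat.zero_le n) hn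
      exact ⟨b, fun i hi hi' => hb i (Nat.le_findGreatest hi hi')⟩
    · exact (hM.1 m n ⟨x⟩).elim fun y => ⟨y, fun i _ ⟨b, hb⟩ =>
        (hn ⟨b, fun j hj => hb j (hj.trans i.zero_le)⟩).elim⟩
  choose f hf using this
  refine ⟨mk f, fun i => ?_⟩
  filter_upwards [h i, out_mk f, hU (eventually_ge_atTop i)] with n hn h hi
  rw [h]
  exact hf n i hi hn

theorem walkOn_eventually [∀ n, L.Structure (M n)] {T : Set (Σ n, L.Relations n)} {d : ℕ}
    {x y : UProd U M} (h : WalkOn T d x y) : ∀ᶠ n in U, WalkOn T d (x.out n) (y.out n) := by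
  induction d generalizing x with
  | zero => exact eq_iff.1 h
  | succ d ih =>
    obtain ⟨z, ⟨s, S, hS, a, ha, ⟨i, rfl⟩, ⟨j, rfl⟩⟩, h⟩ := h
    filter_upwards [(relMap_iff S a).1 ha, ih h] with n hn h
    exact ⟨_, ⟨s, S, hS, _, hn, ⟨i, rfl⟩, ⟨j, rfl⟩⟩, h⟩

theorem walkOn_of_const {N : Type w} [L.Structure N] {T : Set (Σ n, L.Relations n)} {d : ℕ}
    {x y : N} (h : WalkOn T d x y) :
    WalkOn T d (mk fun _ => x : UProd U fun _ => N) (mk fun _ => y) := by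
  induction d generalizing x with
  | zero => cases h; rfl
  | succ d ih =>
    obtain ⟨z, ⟨s, S, hS, a, ha, ⟨i, rfl⟩, ⟨j, rfl⟩⟩, h⟩ := h
    refine ⟨_, ⟨s, S, hS, fun i => mk fun _ => a i, ?_, ⟨i, rfl⟩, ⟨j, rfl⟩⟩, ih h⟩
    rw [relMap_iff]
    filter_upwards [eventually_all.2 fun i => out_mk (U := U) (M := fun _ => N) fun _ => a i]
      with n h
    simpa only [h] using ha

end UProd

/-! ### Countable saturation -/

/-- The relational language with the symbols from `T`. -/
def restrictLanguage {L : FirstOrder.Language.{u, v}} (T : Set (Σ n, L.Relations n)) :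
    FirstOrder.Language.{u, v} where
  Functions _ := PEmpty
  Relations n := {S : L.Relations n // ⟨n, S⟩ ∈ T}

section Saturation

variable {L : FirstOrder.Language.{u, v}} {T : Set (Σ n, L.Relations n)}

instance : (restrictLanguage T).IsRelational := fun _ => inferInstanceAs (IsEmpty PEmpty)

/-- The inclusion of a sublanguage. -/
def restrictLHom (T : Set (Σ n, L.Relations n)) : restrictLanguage T →ᴸ L where
  onFunction _ f := isEmptyElim f
  onRelation _ S := S.1

/-- Countable saturation handles countably many formulas, while `L` may have any cardinality; hence
the restriction to `T`. -/
theorem countable_restrictLanguage (hT : T.Countable) (k : ℕ) :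
    Countable ((restrictLanguage T).BoundedFormula Empty k) := by
  have := hT.to_subtype
  have h1 : Countable (Σ n, (restrictLanguage T).Relations n) := by
    refine Function.Injective.countable (β := T) (f := fun p => ⟨⟨p.1, p.2.1⟩, p.2.2⟩) ?_
    rintro ⟨n, S, hS⟩ ⟨n', S', hS'⟩ h
    obtain ⟨rfl, h⟩ := Sigma.mk.inj_iff.1 (Subtype.ext_iff.1 h)
    cases h
    rfl
  have h2 : IsEmpty (Σ n, (restrictLanguage T).Functions n) := ⟨fun p => PEmpty.elim p.2⟩
  have h3 : Countable (restrictLanguage T).Symbols :=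
    inferInstanceAs (Countable ((Σ n, (restrictLanguage T).Functions n) ⊕
      (Σ n, (restrictLanguage T).Relations n)))
  exact Function.Injective.countable
    (f := fun φ => (⟨k, φ⟩ : Σ n, (restrictLanguage T).BoundedFormula Empty n)) sigma_mk_injective

/-- The truth in a structure of a formula over the symbols of `T`. -/
def HoldsOn {M : Type w} [L.Structure M] {k : ℕ} (ψ : (restrictLanguage T).BoundedFormula Empty k)
    (x : Fin k → M) : Prop :=
  ((restrictLHom T).onBoundedFormula ψ).Realize default x

theorem holdsOn_ex {M : Type w} [L.Structure M] {k : ℕ}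
    (ψ : (restrictLanguage T).BoundedFormula Empty (k + 1)) (x : Fin k → M) :
    HoldsOn ψ.ex x ↔ ∃ b : M, HoldsOn ψ (Fin.snoc x b : Fin (k + 1) → M) := by
  let := (restrictLHom T).reduct M
  have := LHom.isExpansionOn_reduct (restrictLHom T) M
  simp only [HoldsOn, LHom.realize_onBoundedFormula, BoundedFormula.realize_ex]

theorem holdsOn_foldr_inf {M : Type w} [L.Structure M] {k : ℕ}
    (Φ : ℕ → (restrictLanguage T).BoundedFormula Empty k) (l : ℕ) (x : Fin k → M) :
    HoldsOn (((List.range (l + 1)).map Φ).foldr (· ⊓ ·) ⊤) x ↔ ∀ i ≤ l, HoldsOn (Φ i) x := by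
  let := (restrictLHom T).reduct M
  have := LHom.isExpansionOn_reduct (restrictLHom T) M
  simp [HoldsOn, LHom.realize_onBoundedFormula, BoundedFormula.realize_foldr_inf]

/-- Types over finitely many parameters are realized. -/
def IsCountablySaturated (T : Set (Σ n, L.Relations n)) (M : Type w) [L.Structure M] : Prop :=
  ∀ {k : ℕ} (x : Fin k → M) (Φ : ℕ → (restrictLanguage T).BoundedFormula Empty (k + 1)),
    (∀ m, ∃ b : M, ∀ i ≤ m, HoldsOn (Φ i) (Fin.snoc x b : Fin (k + 1) → M)) →
      ∃ b : M, ∀ i, HoldsOn (Φ i) (Fin.snoc x b : Fin (k + 1) → M)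

theorem UProd.isCountablySaturated [L.IsRelational] {U : Ultrafilter ℕ}
    (hU : (U : Filter ℕ) ≤ atTop)
    {M : ℕ → Type w} [∀ n, L.Structure (M n)] [UniformlyNonempty M] :
    IsCountablySaturated T (UProd U M) := by
  intro k x Φ h
  have snoc_out : ∀ (a : UProd U M) (n : ℕ), (fun i => ((Fin.snoc x a : _ → UProd U M) i).out n) =
      Fin.snoc (fun i => (x i).out n) (a.out n) := by
    intro a n
    funext i
    induction i using Fin.lastCases with
    | last => simp
    | cast i => simp
  have key : ∀ i b, HoldsOn (Φ i) (Fin.snoc x b : Fin (k + 1) → UProd U M) ↔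
      ∀ᶠ n in U, HoldsOn (Φ i) (Fin.snoc (fun i => (x i).out n) (b.out n) : Fin (k + 1) → M n) := by
    intro i b
    simp only [HoldsOn, UProd.realize_iff, snoc_out]
  simp only [key] at h ⊢
  refine UProd.exists_forall_eventually_mem hU
    (D := fun i n => {b | HoldsOn (Φ i) (Fin.snoc (fun i => (x i).out n) b : Fin (k + 1) → M n)}) ?_
  intro m
  obtain ⟨b, hb⟩ := h m
  have := (Set.finite_Iic m).eventually_all.2 hb
  exact this.mono fun n hn => ⟨_, hn⟩

variable {M : Type w} {N : Type w'} [L.Structure M] [L.Structure N]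

/-- The finite partial elementary maps (with respect to the symbols of `T`) that extend a given
partial map. -/
def elementaryFamily (T : Set (Σ n, L.Relations n)) {k : ℕ} (x₀ : Fin k → M) (y₀ : Fin k → N) :
    Set (Set (M × N)) :=
  {F | (∀ i, (x₀ i, y₀ i) ∈ F) ∧ ∃ (m : ℕ) (x : Fin m → M) (y : Fin m → N),
    (∀ ψ : (restrictLanguage T).BoundedFormula Empty m, HoldsOn ψ x ↔ HoldsOn ψ y) ∧
      F = Set.range fun i => (x i, y i)}

/-- The answer to a new element realizes, over the images, the type of that element over the
elements already played. -/
theorem isForthSystem_elementaryFamily [L.IsRelational] (hT : T.Countable)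
    (hN : IsCountablySaturated T N) {k : ℕ} (x₀ : Fin k → M) (y₀ : Fin k → N) :
    IsForthSystem T (elementaryFamily T x₀ y₀) where
  rel := by
    rintro F ⟨-, m, x, y, hxy, rfl⟩ s S hS x' y' h
    choose t ht using h
    have h1 : x' = fun i => x (t i) := funext fun i => (congrArg Prod.fst (ht i)).symm
    have h2 : y' = fun i => y (t i) := funext fun i => (congrArg Prod.snd (ht i)).symm
    subst h1 h2
    exact (hxy (Relations.boundedFormula (L := restrictLanguage T) ⟨S, hS⟩
      fun i => Term.var (Sum.inr (t i)))).1
  eq := by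
    rintro F ⟨-, m, x, y, hxy, rfl⟩ a a' b b' ⟨i, hi⟩ ⟨j, hj⟩
    cases hi
    cases hj
    exact (hxy (Term.bdEqual (Term.var (Sum.inr i)) (Term.var (Sum.inr j)))).1
  forth := by
    rintro F ⟨h₀, m, x, y, hxy, rfl⟩ a
    have := countable_restrictLanguage hT (m + 1)
    obtain ⟨e, he⟩ := exists_surjective_nat
      ((restrictLanguage T).BoundedFormula Empty (m + 1))
    classical
    -- `Φ` lists the complete type of `a` over `x`.
    let Φ : ℕ → (restrictLanguage T).BoundedFormula Empty (m + 1) := fun i =>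
      if HoldsOn (e i) (Fin.snoc x a : Fin (m + 1) → M) then e i else (e i).not
    have hΦ : ∀ i, HoldsOn (Φ i) (Fin.snoc x a : Fin (m + 1) → M) := by
      intro i
      by_cases h : HoldsOn (e i) (Fin.snoc x a : Fin (m + 1) → M)
      · simpa only [Φ, if_pos h] using h
      · simp only [Φ, if_neg h]
        exact h
    -- Finite parts of the type are satisfiable over `y`, since their satisfiability is an
    -- existential formula that holds at `x`.
    obtain ⟨b, hb⟩ := hN y Φ fun l => by
      have h1 : HoldsOn ((((List.range (l + 1)).map Φ).foldr (· ⊓ ·) ⊤).ex) x := by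
        rw [holdsOn_ex]
        exact ⟨a, (holdsOn_foldr_inf _ _ _).2 fun i _ => hΦ i⟩
      obtain ⟨b, hb⟩ := (holdsOn_ex _ _).1 ((hxy _).1 h1)
      exact ⟨b, (holdsOn_foldr_inf _ _ _).1 hb⟩
    have hab : ∀ ψ : (restrictLanguage T).BoundedFormula Empty (m + 1),
        HoldsOn ψ (Fin.snoc x a : Fin (m + 1) → M) ↔
          HoldsOn ψ (Fin.snoc y b : Fin (m + 1) → N) := by
      intro ψ
      obtain ⟨i, rfl⟩ := he ψ
      have := hb i
      by_cases h : HoldsOn (e i) (Fin.snoc x a : Fin (m + 1) → M)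
      · simp only [Φ, if_pos h] at this
        exact iff_of_true h this
      · simp only [Φ, if_neg h] at this
        exact iff_of_false h this
    have hsub : (Set.range fun i => (x i, y i)) ⊆
        Set.range fun i : Fin (m + 1) => ((Fin.snoc x a : _ → M) i, (Fin.snoc y b : _ → N) i) := by
      rintro _ ⟨i, rfl⟩
      exact ⟨i.castSucc, by simp⟩
    exact ⟨_, ⟨fun i => hsub (h₀ i), m + 1, _, _, hab, rfl⟩, hsub, b, Fin.last m, by simp⟩

theorem swap_mem_elementaryFamily {k : ℕ} {x₀ : Fin k → M} {y₀ : Fin k → N} {F : Set (M × N)}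
    (hF : F ∈ elementaryFamily T x₀ y₀) : Prod.swap ⁻¹' F ∈ elementaryFamily T y₀ x₀ := by
  obtain ⟨h₀, m, x, y, hxy, rfl⟩ := hF
  refine ⟨h₀, m, y, x, fun ψ => (hxy ψ).symm, ?_⟩
  ext ⟨a, b⟩
  simp [Prod.ext_iff, and_comm]

theorem swapFamily_elementaryFamily {k : ℕ} (x₀ : Fin k → M) (y₀ : Fin k → N) :
    swapFamily (elementaryFamily T x₀ y₀) = elementaryFamily T y₀ x₀ :=
  Set.ext fun _ => ⟨fun h => swap_mem_elementaryFamily h, fun h => swap_mem_elementaryFamily h⟩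

theorem isBackForthSystem_elementaryFamily [L.IsRelational] (hT : T.Countable)
    (hM : IsCountablySaturated T M) (hN : IsCountablySaturated T N) {k : ℕ} (x₀ : Fin k → M)
    (y₀ : Fin k → N) : IsBackForthSystem T (elementaryFamily T x₀ y₀) := by
  refine ⟨isForthSystem_elementaryFamily hT hN x₀ y₀, ?_⟩
  rw [swapFamily_elementaryFamily]
  exact isForthSystem_elementaryFamily hT hM y₀ x₀

/-- Ultraproducts of two sequences of structures with eventually the same theory are back-and-forth
equivalent. -/
theorem UProd.exists_isBackForthSystem [L.IsRelational] (hT : T.Countable) {U : Ultrafilter ℕ}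
    (hU : (U : Filter ℕ) ≤ atTop) {M : ℕ → Type w} {N : ℕ → Type w'} [∀ n, L.Structure (M n)]
    [∀ n, L.Structure (N n)] [UniformlyNonempty M] [UniformlyNonempty N] {k : ℕ}
    (x : ∀ n, Fin k → M n) (y : ∀ n, Fin k → N n)
    (h : ∀ ψ : L.BoundedFormula Empty k, ∀ᶠ n in U,
      ψ.Realize default (x n) ↔ ψ.Realize default (y n)) :
    ∃ 𝓕 : Set (Set (UProd U M × UProd U N)), IsBackForthSystem T 𝓕 ∧ 𝓕.Nonempty ∧
      ∀ F ∈ 𝓕, ∀ i, (UProd.mk fun n => x n i, UProd.mk fun n => y n i) ∈ F := by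
  refine ⟨elementaryFamily T (fun i => UProd.mk fun n => x n i) (fun i => UProd.mk fun n => y n i),
    isBackForthSystem_elementaryFamily hT (UProd.isCountablySaturated hU)
      (UProd.isCountablySaturated hU) _ _,
    ⟨_, fun i => Set.mem_range_self i, k, _, _, fun ψ => ?_, rfl⟩, fun F hF => hF.1⟩
  simp only [HoldsOn, UProd.realize_iff]
  refine eventually_congr ?_
  filter_upwards [h ((restrictLHom T).onBoundedFormula ψ),
    eventually_all.2 fun i => UProd.out_mk (U := U) fun n => x n i,
    eventually_all.2 fun i => UProd.out_mk (U := U) fun n => y n i] with n hn hx hy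
  simpa only [hx, hy] using hn

end Saturation

/-! ### Decompositions into a fragmented base structure and copies of pieces of a gadget -/

/-- Tuples of the length of the subedges of the class `X`. -/
abbrev EdgeTuple {r : ℕ} (σ : Setoid (Fin r)) (B : Type w) (X : Option (Quotient σ)) : Type w :=
  Fin ((classOf σ X).card + 1) → B

/-- The symbols of `L_σ` that correspond to a set of symbols of `L`, with all added symbols. -/
def fragSymbolSet {L : FirstOrder.Language.{u, v}} {r : ℕ} (σ : Setoid (Fin r))
    (T : Set (Σ n, L.Relations n)) : Set (Σ n, (fragLanguage L σ).Relations n) :=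
  ((fun p => ⟨p.1, Sum.inl p.2⟩) '' T) ∪ Set.range fun X => ⟨_, Sum.inr (FragRel.sub X)⟩

theorem finite_fragSymbolSet {L : FirstOrder.Language.{u, v}} {r : ℕ} (σ : Setoid (Fin r))
    {T : Set (Σ n, L.Relations n)} (hT : T.Finite) : (fragSymbolSet σ T).Finite :=
  (hT.image _).union (Set.finite_range _)

theorem eq_some_classEnum {r : ℕ} (σ : Setoid (Fin r)) (X : Option (Quotient σ))
    (t : Fin (classOf σ X).card) : X = some (Quotient.mk σ (classEnum σ X t)) := by
  have h : classEnum σ X t ∈ classOf σ X := Finset.orderEmbOfFin_mem _ _ _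
  cases X with
  | none => simp [classOf] at h
  | some q => simp only [classOf, Finset.mem_filter] at h; rw [h.2]

theorem exists_classEnum_eq {r : ℕ} (σ : Setoid (Fin r)) (i : Fin r) :
    ∃ t, classEnum σ (some (Quotient.mk σ i)) t = i := by
  have h : i ∈ classOf σ (some (Quotient.mk σ i)) := by simp [classOf]
  have h2 : i ∈ Set.range (classEnum σ (some (Quotient.mk σ i))) := by
    simp only [classEnum, Finset.range_orderEmbOfFin]
    exact h
  exact h2

section Decomposition

variable {L : FirstOrder.Language.{u, v}} {r : ℕ} {σ : Setoid (Fin r)}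

/-- The structure `M` is composed of the non-auxiliary vertices of `B` and of copies of vertices of
`H`: `base b m` states that `m` is the vertex `b`, and `cop X e h m` states that `m` is the vertex
`h` in the copy that replaces the subedge `e` of the class `X`; this copy has the vertices `h` with
`lab X h`. -/
structure IsDecomposition (T : Set (Σ n, L.Relations n)) {B : Type w} {M : Type w'} {H : Type w₁}
    [(fragLanguage L σ).Structure B] [L.Structure M] [L.Structure H] (root : Fin r → H)
    (lab : Option (Quotient σ) → H → Prop) (base : B → M → Prop)
    (cop : ∀ X, EdgeTuple σ B X → H → M → Prop) : Prop where
  -- A subedge is demanded for every admissible label, because labels are not assumed unique at this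
  -- stage; the same holds in `rel_cases`.
  cover : ∀ m, (∃ b, base b m) ∨ ∃ h, (∀ i, h ≠ root i) ∧ ∀ X, lab X h → ∃ e, cop X e h m
  not_aux : ∀ {b m}, base b m → ¬ IsAuxiliary L σ b
  exists_base : ∀ {b}, ¬ IsAuxiliary L σ b → ∃ m, base b m
  base_left : ∀ {b m m'}, base b m → base b m' → m = m'
  base_right : ∀ {b b' m}, base b m → base b' m → b = b'
  edge_mem : ∀ {X e h m}, cop X e h m → e ∈ subedges L σ B X
  lab_of_cop : ∀ {X e h m}, cop X e h m → lab X h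
  exists_cop : ∀ {X e h}, e ∈ subedges L σ B X → lab X h → ∃ m, cop X e h m
  cop_left : ∀ {X e h m m'}, cop X e h m → cop X e h m' → m = m'
  edge_inj : ∀ {X e e' h h' m}, cop X e h m → cop X e' h' m → (∀ i, h ≠ root i) → e = e'
  vertex_inj : ∀ {X X' e e' h h' m}, cop X e h m → cop X' e' h' m → (∀ i, h ≠ root i) → h = h'
  base_of_cop : ∀ {X e t m}, cop X e (root (classEnum σ X t)) m → base (e t.castSucc) m
  root_of_base : ∀ {X e h b m}, base b m → cop X e h m →
    ∃ t, h = root (classEnum σ X t) ∧ e t.castSucc = b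
  rel_base : ∀ {s : ℕ} (S : L.Relations s), ⟨s, S⟩ ∈ T → ∀ {b : Fin s → B} {x : Fin s → M},
    Structure.RelMap (L := fragLanguage L σ) (Sum.inl S) b → (∀ i, base (b i) (x i)) →
      Structure.RelMap S x
  rel_cop : ∀ {s : ℕ} (S : L.Relations s), ⟨s, S⟩ ∈ T → ∀ {X e} {h : Fin s → H} {x : Fin s → M},
    Structure.RelMap S h → e ∈ subedges L σ B X → (∀ i, cop X e (h i) (x i)) →
      Structure.RelMap S x
  rel_cases : ∀ {s : ℕ} (S : L.Relations s), ⟨s, S⟩ ∈ T → ∀ {x : Fin s → M}, Structure.RelMap S x →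
    (∃ b : Fin s → B, Structure.RelMap (L := fragLanguage L σ) (Sum.inl S) b ∧
      ∀ i, base (b i) (x i)) ∨
    ∃ h : Fin s → H, Structure.RelMap S h ∧ ∀ X, (∀ i, lab X (h i)) →
      ∃ e ∈ subedges L σ B X, ∀ i, cop X e (h i) (x i)

/-- A partition of the vertices of a gadget into unions of components that contain the roots with
index in one class. -/
structure IsPieceLabelling (T : Set (Σ n, L.Relations n)) {H : Type w} [L.Structure H]
    (root : Fin r → H) (lab : Option (Quotient σ) → H → Prop) : Prop where
  total : ∀ h, ∃ X, lab X h
  unique : ∀ {X X' h}, lab X h → lab X' h → X = X'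
  root : ∀ i, lab (some (Quotient.mk σ i)) (root i)
  adj : ∀ {X h h'}, lab X h → AdjOn T h h' → lab X h'

theorem IsPieceLabelling.reach {T : Set (Σ n, L.Relations n)} {H : Type w} [L.Structure H]
    {root : Fin r → H} {lab : Option (Quotient σ) → H → Prop} (hl : IsPieceLabelling T root lab)
    {X : Option (Quotient σ)} {h h' : H} (hX : lab X h) (hr : ReachOn T h h') : lab X h' := by
  obtain ⟨d, hd⟩ := hr
  induction d generalizing h with
  | zero => cases hd; exact hX
  | succ d ih =>
    obtain ⟨t, ht, hd⟩ := hd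
    exact ih (hl.adj hX ht) hd

theorem IsPieceLabelling.classEnum {T : Set (Σ n, L.Relations n)} {H : Type w} [L.Structure H]
    {root : Fin r → H} {lab : Option (Quotient σ) → H → Prop} (hl : IsPieceLabelling T root lab)
    (X : Option (Quotient σ)) (t : Fin (classOf σ X).card) : lab X (root (classEnum σ X t)) := by
  conv => enter [1]; rw [eq_some_classEnum σ X t]
  exact hl.root _

/-- There are at least `m` subedges of the class `X`. -/
def HasEdges (L : FirstOrder.Language.{u, v}) (σ : Setoid (Fin r)) (B : Type w)
    [(fragLanguage L σ).Structure B] (X : Option (Quotient σ)) (m : ℕ) : Prop :=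
  ∃ g : Fin m → EdgeTuple σ B X, Function.Injective g ∧ ∀ k, g k ∈ subedges L σ B X

theorem HasEdges.of_injective {B : Type w} [(fragLanguage L σ).Structure B]
    {X : Option (Quotient σ)} {ι : Type} [Finite ι] {g : ι → EdgeTuple σ B X}
    (hg : Function.Injective g) (hmem : ∀ k, g k ∈ subedges L σ B X) :
    HasEdges L σ B X (Nat.card ι) :=
  ⟨g ∘ (Finite.equivFin ι).symm, hg.comp (Equiv.injective _), fun _ => hmem _⟩

theorem HasEdges.exists_notMem_range {B : Type w} [(fragLanguage L σ).Structure B]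
    {X : Option (Quotient σ)} {ι : Type} [Finite ι] (h : HasEdges L σ B X (Nat.card (Option ι)))
    (f : ι → EdgeTuple σ B X) : ∃ e ∈ subedges L σ B X, ∀ j, f j ≠ e := by
  obtain ⟨g, hg, hmem⟩ := h
  by_contra hc
  push Not at hc
  choose c hc using fun k => hc (g k) (hmem k)
  have hinj : Function.Injective c := fun k k' hk => hg (by rw [← hc k, ← hc k', hk])
  have := Nat.card_le_card_of_injective c hinj
  rw [Nat.card_fin, Finite.card_option] at this
  omega

/-! ### Positions of the composed game -/

variable {B₁ : Type w} {M₁ : Type w'} {H₁ : Type w₁} {B₂ : Type w₂} {M₂ : Type w₃} {H₂ : Type u₁}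

/-- A position in the back-and-forth game on two decomposed structures: a partial map of base
vertices, partial maps between the copies replacing corresponding subedges, and partial maps on
the vertices that are not connected to roots, in finitely many corresponding copies. -/
structure Position (L : FirstOrder.Language.{u, v}) (σ : Setoid (Fin r))
    [(fragLanguage L σ).Structure B₁] [(fragLanguage L σ).Structure B₂]
    (𝓑 : Set (Set (B₁ × B₂))) (𝓗 : Set (Set (H₁ × H₂))) where
  F : Set (B₁ × B₂)
  F_mem : F ∈ 𝓑
  Γ : (Σ X, EdgeTuple σ B₁ X × EdgeTuple σ B₂ X) → Set (H₁ × H₂)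
  Γ_mem : ∀ k, Γ k ∈ 𝓗
  ι : Type
  finite : Finite ι
  -- The subedges `f₁ j X` and `f₂ j X` need not correspond under `F`, nor do the subedges with the
  -- same `j` need to come from one edge: orphans do not see the base.
  f₁ : ι → ∀ X, EdgeTuple σ B₁ X
  f₂ : ι → ∀ X, EdgeTuple σ B₂ X
  f₁_mem : ∀ j X, f₁ j X ∈ subedges L σ B₁ X
  f₂_mem : ∀ j X, f₂ j X ∈ subedges L σ B₂ X
  f₁_inj : ∀ {j j' X}, f₁ j X = f₁ j' X → j = j'
  f₂_inj : ∀ {j j' X}, f₂ j X = f₂ j' X → j = j'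
  Δ : ι → Set (H₁ × H₂)
  Δ_mem : ∀ j, Δ j ∈ 𝓗

variable [(fragLanguage L σ).Structure B₁] [(fragLanguage L σ).Structure B₂]
  {𝓑 : Set (Set (B₁ × B₂))} {𝓗 : Set (Set (H₁ × H₂))}

/-- The inverse position. -/
def Position.symm (p : Position L σ 𝓑 𝓗) : Position L σ (swapFamily 𝓑) (swapFamily 𝓗) where
  F := Prod.swap ⁻¹' p.F
  F_mem := swap_mem_swapFamily p.F_mem
  Γ k := Prod.swap ⁻¹' p.Γ ⟨k.1, k.2.swap⟩
  Γ_mem _ := swap_mem_swapFamily (p.Γ_mem _)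
  ι := p.ι
  finite := p.finite
  f₁ := p.f₂
  f₂ := p.f₁
  f₁_mem := p.f₂_mem
  f₂_mem := p.f₁_mem
  f₁_inj := p.f₂_inj
  f₂_inj := p.f₁_inj
  Δ j := Prod.swap ⁻¹' p.Δ j
  Δ_mem _ := swap_mem_swapFamily (p.Δ_mem _)

variable [L.Structure H₁] [L.Structure H₂]

/-- The partial map of vertices determined by a position. -/
inductive Position.Rel (T : Set (Σ n, L.Relations n)) (root₁ : Fin r → H₁) (root₂ : Fin r → H₂)
    (base₁ : B₁ → M₁ → Prop) (cop₁ : ∀ X, EdgeTuple σ B₁ X → H₁ → M₁ → Prop)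
    (base₂ : B₂ → M₂ → Prop) (cop₂ : ∀ X, EdgeTuple σ B₂ X → H₂ → M₂ → Prop)
    (p : Position L σ 𝓑 𝓗) : M₁ → M₂ → Prop
  | base {b b' x y} (hF : (b, b') ∈ p.F) (hx : base₁ b x) (hy : base₂ b' y) :
      Position.Rel T root₁ root₂ base₁ cop₁ base₂ cop₂ p x y
  | rooted {X e e' h h' x y} (hF : ∀ t, (e t, e' t) ∈ p.F) (hΓ : (h, h') ∈ p.Γ ⟨X, e, e'⟩)
      (hn : ∀ i, h ≠ root₁ i) (hn' : ∀ i, h' ≠ root₂ i) (i : Fin r)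
      (hr : ReachOn T (root₁ i) h) (hr' : ReachOn T (root₂ i) h')
      (hx : cop₁ X e h x) (hy : cop₂ X e' h' y) :
      Position.Rel T root₁ root₂ base₁ cop₁ base₂ cop₂ p x y
  | orphan {X X' h h' x y} (j : p.ι) (hΔ : (h, h') ∈ p.Δ j)
      (hr : ∀ i, ¬ ReachOn T (root₁ i) h) (hr' : ∀ i, ¬ ReachOn T (root₂ i) h')
      (hx : cop₁ X (p.f₁ j X) h x) (hy : cop₂ X' (p.f₂ j X') h' y) :
      Position.Rel T root₁ root₂ base₁ cop₁ base₂ cop₂ p x y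

variable {T : Set (Σ n, L.Relations n)} {root₁ : Fin r → H₁} {root₂ : Fin r → H₂}
  {lab₁ : Option (Quotient σ) → H₁ → Prop} {lab₂ : Option (Quotient σ) → H₂ → Prop}
  {base₁ : B₁ → M₁ → Prop} {cop₁ : ∀ X, EdgeTuple σ B₁ X → H₁ → M₁ → Prop}
  {base₂ : B₂ → M₂ → Prop} {cop₂ : ∀ X, EdgeTuple σ B₂ X → H₂ → M₂ → Prop}

theorem Position.Rel.symm {p : Position L σ 𝓑 𝓗} {x : M₁} {y : M₂}
    (h : p.Rel T root₁ root₂ base₁ cop₁ base₂ cop₂ x y) :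
    p.symm.Rel T root₂ root₁ base₂ cop₂ base₁ cop₁ y x := by
  cases h with
  | base hF hx hy => exact .base (p := p.symm) hF hy hx
  | rooted hF hΓ hn hn' i hr hr' hx hy =>
    exact .rooted (p := p.symm) hF hΓ hn' hn i hr' hr hy hx
  | orphan j hΔ hr hr' hx hy => exact .orphan (p := p.symm) j hΔ hr' hr hy hx

theorem Position.rel_symm_iff {p : Position L σ 𝓑 𝓗} {x : M₁} {y : M₂} :
    p.symm.Rel T root₂ root₁ base₂ cop₂ base₁ cop₁ y x ↔
      p.Rel T root₁ root₂ base₁ cop₁ base₂ cop₂ x y :=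
  ⟨fun h => h.symm, fun h => h.symm⟩

/-- The family of the partial maps determined by positions. -/
def positionFamily (T : Set (Σ n, L.Relations n)) (𝓑 : Set (Set (B₁ × B₂)))
    (𝓗 : Set (Set (H₁ × H₂))) (root₁ : Fin r → H₁) (root₂ : Fin r → H₂)
    (base₁ : B₁ → M₁ → Prop) (cop₁ : ∀ X, EdgeTuple σ B₁ X → H₁ → M₁ → Prop)
    (base₂ : B₂ → M₂ → Prop) (cop₂ : ∀ X, EdgeTuple σ B₂ X → H₂ → M₂ → Prop) :
    Set (Set (M₁ × M₂)) :=
  {F | ∃ p : Position L σ 𝓑 𝓗, F = {z | p.Rel T root₁ root₂ base₁ cop₁ base₂ cop₂ z.1 z.2}}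

theorem swapFamily_positionFamily :
    swapFamily (positionFamily T 𝓑 𝓗 root₁ root₂ base₁ cop₁ base₂ cop₂) =
      positionFamily T (swapFamily 𝓑) (swapFamily 𝓗) root₂ root₁ base₂ cop₂ base₁ cop₁ := by
  ext F
  constructor
  · rintro ⟨p, hp⟩
    refine ⟨p.symm, ?_⟩
    ext ⟨y, x⟩
    exact (Set.ext_iff.1 hp (x, y)).trans Position.rel_symm_iff.symm
  · rintro ⟨p, rfl⟩
    refine ⟨p.symm, ?_⟩
    ext ⟨x, y⟩
    exact Position.rel_symm_iff.symm

theorem Position.Rel.mono {p p' : Position L σ 𝓑 𝓗} (hF : p.F ⊆ p'.F) (hΓ : ∀ k, p.Γ k ⊆ p'.Γ k)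
    (g : p.ι → p'.ι) (hf₁ : ∀ j, p'.f₁ (g j) = p.f₁ j) (hf₂ : ∀ j, p'.f₂ (g j) = p.f₂ j)
    (hΔ : ∀ j, p.Δ j ⊆ p'.Δ (g j)) {x : M₁} {y : M₂}
    (h : p.Rel T root₁ root₂ base₁ cop₁ base₂ cop₂ x y) :
    p'.Rel T root₁ root₂ base₁ cop₁ base₂ cop₂ x y := by
  cases h with
  | base h hx hy => exact .base (hF h) hx hy
  | rooted h h' hn hn' i hr hr' hx hy =>
    exact .rooted (fun t => hF (h t)) (hΓ _ h') hn hn' i hr hr' hx hy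
  | orphan j h hr hr' hx hy =>
    exact .orphan (g j) (hΔ j h) hr hr' (by rwa [hf₁]) (by rwa [hf₂])

/-- The back-and-forth properties of the parts of two decomposed structures. -/
structure PartsBackForth (σ : Setoid (Fin r)) [(fragLanguage L σ).Structure B₁]
    [(fragLanguage L σ).Structure B₂] (T : Set (Σ n, L.Relations n)) (𝓑 : Set (Set (B₁ × B₂)))
    (𝓗 : Set (Set (H₁ × H₂))) (root₁ : Fin r → H₁) (root₂ : Fin r → H₂) : Prop where
  base : IsBackForthSystem (fragSymbolSet σ T) 𝓑
  gadget : IsBackForthSystem T 𝓗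
  root_mem : ∀ G ∈ 𝓗, ∀ i, (root₁ i, root₂ i) ∈ G
  hasEdges₁ : ∀ X Y m, HasEdges L σ B₁ X m → HasEdges L σ B₁ Y m ∧ HasEdges L σ B₂ Y m
  hasEdges₂ : ∀ X Y m, HasEdges L σ B₂ X m → HasEdges L σ B₂ Y m ∧ HasEdges L σ B₁ Y m

namespace PartsBackForth

theorem symm (h : PartsBackForth σ T 𝓑 𝓗 root₁ root₂) :
    PartsBackForth σ T (swapFamily 𝓑) (swapFamily 𝓗) root₂ root₁ :=
  ⟨h.base.symm, h.gadget.symm, fun _ hG i => h.root_mem _ hG i, h.hasEdges₂, h.hasEdges₁⟩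

theorem rel_inl (h : PartsBackForth σ T 𝓑 𝓗 root₁ root₂) {F : Set (B₁ × B₂)} (hF : F ∈ 𝓑) {s : ℕ}
    {S : L.Relations s} (hS : ⟨s, S⟩ ∈ T) {b : Fin s → B₁} {b' : Fin s → B₂}
    (hb : ∀ i, (b i, b' i) ∈ F) (hR : Structure.RelMap (L := fragLanguage L σ) (Sum.inl S) b) :
    Structure.RelMap (L := fragLanguage L σ) (Sum.inl S) b' :=
  h.base.left.rel F hF _ (Or.inl ⟨_, hS, rfl⟩) b b' hb hR

theorem map_subedges (h : PartsBackForth σ T 𝓑 𝓗 root₁ root₂) {F : Set (B₁ × B₂)} (hF : F ∈ 𝓑)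
    {X : Option (Quotient σ)} {e : EdgeTuple σ B₁ X} {e' : EdgeTuple σ B₂ X}
    (hb : ∀ t, (e t, e' t) ∈ F) (he : e ∈ subedges L σ B₁ X) : e' ∈ subedges L σ B₂ X :=
  h.base.left.rel F hF _ (Or.inr ⟨X, rfl⟩) e e' hb he

/-- Being auxiliary is an existential property, so its negation is transferred by playing the
witnessing subedge on the other side. -/
theorem not_aux (h : PartsBackForth σ T 𝓑 𝓗 root₁ root₂) {F : Set (B₁ × B₂)} (hF : F ∈ 𝓑) {b : B₁}
    {b' : B₂} (hb : (b, b') ∈ F) (hn : ¬ IsAuxiliary L σ b) : ¬ IsAuxiliary L σ b' := by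
  rintro ⟨X, e, he, rfl⟩
  obtain ⟨F', hF', hsub, e', he'⟩ := h.base.right.forth_tuple (swap_mem_swapFamily hF) e
  exact hn ⟨X, e', h.symm.map_subedges hF' he' he,
    h.base.right.eq F' hF' (he' (Fin.last _)) (hsub (a := (_, _)) hb) rfl⟩

theorem ne_root (h : PartsBackForth σ T 𝓑 𝓗 root₁ root₂) {G : Set (H₁ × H₂)} (hG : G ∈ 𝓗) {x : H₁}
    {y : H₂} (hxy : (x, y) ∈ G) (hn : ∀ i, x ≠ root₁ i) (i : Fin r) : y ≠ root₂ i :=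
  fun hy => hn i ((h.gadget.eq_iff hG hxy (h.root_mem G hG i)).2 hy)

theorem reach (h : PartsBackForth σ T 𝓑 𝓗 root₁ root₂) {G : Set (H₁ × H₂)} (hG : G ∈ 𝓗) {x : H₁}
    {y : H₂} (hxy : (x, y) ∈ G) {i : Fin r} (hr : ReachOn T (root₁ i) x) :
    ReachOn T (root₂ i) y :=
  hr.imp fun _ => h.gadget.left.walkOn hG (h.root_mem G hG i) hxy

theorem exists_fresh_of_hasEdges {B : Type w} [(fragLanguage L σ).Structure B] {ι : Type}
    [Finite ι] (f : ι → ∀ X, EdgeTuple σ B X)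
    (h : ∀ X, HasEdges L σ B X (Nat.card (Option ι))) :
    ∃ e : ∀ X, EdgeTuple σ B X, (∀ X, e X ∈ subedges L σ B X) ∧ ∀ j X, f j X ≠ e X := by
  choose e he hne using fun X => (h X).exists_notMem_range fun j => f j X
  exact ⟨e, he, fun j X => hne X j⟩

/-- If `e` is not yet matched, a new index needs an unused subedge of every class on both sides. The
comparison of numbers of subedges supplies them. -/
theorem exists_insert_orphan (h : PartsBackForth σ T 𝓑 𝓗 root₁ root₂) (p : Position L σ 𝓑 𝓗)
    {X : Option (Quotient σ)} {e : EdgeTuple σ B₁ X} (he : e ∈ subedges L σ B₁ X) (g : H₁) :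
    ∃ p' : Position L σ 𝓑 𝓗,
      (∀ x y, p.Rel T root₁ root₂ base₁ cop₁ base₂ cop₂ x y →
        p'.Rel T root₁ root₂ base₁ cop₁ base₂ cop₂ x y) ∧
      ∃ (j : p'.ι) (g' : H₂), p'.f₁ j X = e ∧ (g, g') ∈ p'.Δ j := by
  classical
  have := p.finite
  by_cases hj : ∃ j, p.f₁ j X = e
  · obtain ⟨j, hj⟩ := hj
    obtain ⟨G, hG, hsub, g', hg'⟩ := h.gadget.left.forth _ (p.Δ_mem j) g
    have hΔ : ∀ k, Function.update p.Δ j G k ∈ 𝓗 := by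
      intro k
      rcases eq_or_ne k j with rfl | hk
      · rwa [Function.update_self]
      · rw [Function.update_of_ne hk]
        exact p.Δ_mem k
    let p' : Position L σ 𝓑 𝓗 := { p with Δ := Function.update p.Δ j G, Δ_mem := hΔ }
    refine ⟨p', fun x y hxy => Position.Rel.mono (p := p) (p' := p') subset_rfl
      (fun _ => subset_rfl) id
        (fun _ => rfl) (fun _ => rfl) (fun k => ?_) hxy, j, g', hj, ?_⟩
    · change p.Δ k ⊆ Function.update p.Δ j G k
      rcases eq_or_ne k j with rfl | hk
      · rwa [Function.update_self]
      · rw [Function.update_of_ne hk]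
    · change (g, g') ∈ Function.update p.Δ j G j
      rwa [Function.update_self]
  · push Not at hj
    -- `e` and the subedges used so far are one more than the indices. This number is available in
    -- every class on both sides, so each class has an unused subedge.
    have hX : HasEdges L σ B₁ X (Nat.card (Option p.ι)) := by
      refine HasEdges.of_injective (g := fun o => o.elim e fun j => p.f₁ j X) ?_ ?_
      · rintro (_ | j) (_ | j') hjj
        · rfl
        · exact (hj j' hjj.symm).elim
        · exact (hj j hjj).elim
        · exact congrArg some (p.f₁_inj hjj)
      · rintro (_ | j)
        · exact he
        · exact p.f₁_mem j X
    obtain ⟨e₁, he₁, hne₁⟩ := exists_fresh_of_hasEdges p.f₁ fun Y => (h.hasEdges₁ X Y _ hX).1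
    obtain ⟨e₂, he₂, hne₂⟩ := exists_fresh_of_hasEdges p.f₂ fun Y => (h.hasEdges₁ X Y _ hX).2
    have hu₁ : ∀ Y, Function.update e₁ X e Y ∈ subedges L σ B₁ Y := by
      intro Y
      rcases eq_or_ne Y X with rfl | hY
      · rwa [Function.update_self]
      · rw [Function.update_of_ne hY]
        exact he₁ Y
    have hun₁ : ∀ j Y, p.f₁ j Y ≠ Function.update e₁ X e Y := by
      intro j Y
      rcases eq_or_ne Y X with rfl | hY
      · rw [Function.update_self]
        exact hj j
      · rw [Function.update_of_ne hY]
        exact hne₁ j Y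
    -- Any member of `𝓗` could start the game on the new copy; `Γ` merely provides one.
    obtain ⟨G, hG, -, g', hg'⟩ := h.gadget.left.forth _ (p.Γ_mem ⟨X, e, e₂ X⟩) g
    let p' : Position L σ 𝓑 𝓗 :=
      { p with
        ι := Option p.ι
        finite := inferInstance
        f₁ := fun o => o.elim (Function.update e₁ X e) p.f₁
        f₂ := fun o => o.elim e₂ p.f₂
        f₁_mem := Option.rec hu₁ p.f₁_mem
        f₂_mem := Option.rec he₂ p.f₂_mem
        f₁_inj := by
          rintro (_ | j) (_ | j') Y hjj
          · rfl
          · exact (hun₁ j' Y hjj.symm).elim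
          · exact (hun₁ j Y hjj).elim
          · exact congrArg some (p.f₁_inj hjj)
        f₂_inj := by
          rintro (_ | j) (_ | j') Y hjj
          · rfl
          · exact (hne₂ j' Y hjj.symm).elim
          · exact (hne₂ j Y hjj).elim
          · exact congrArg some (p.f₂_inj hjj)
        Δ := fun o => o.elim G p.Δ
        Δ_mem := Option.rec hG p.Δ_mem }
    exact ⟨p', fun x y hxy => Position.Rel.mono (p := p) (p' := p') subset_rfl
      (fun _ => subset_rfl) some
      (fun _ => rfl) (fun _ => rfl) (fun _ => subset_rfl) hxy, none, g',
      Function.update_self _ _ _, hg'⟩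

/-- Here the partner of `e` is dictated by the base game, which is extended to all vertices of `e`,
the auxiliary one included. The gadget game on the pair of subedges then answers `g`. -/
theorem exists_insert_rooted (h : PartsBackForth σ T 𝓑 𝓗 root₁ root₂) (p : Position L σ 𝓑 𝓗)
    {X : Option (Quotient σ)} (e : EdgeTuple σ B₁ X) (g : H₁) :
    ∃ p' : Position L σ 𝓑 𝓗,
      (∀ x y, p.Rel T root₁ root₂ base₁ cop₁ base₂ cop₂ x y →
        p'.Rel T root₁ root₂ base₁ cop₁ base₂ cop₂ x y) ∧
      ∃ (e' : EdgeTuple σ B₂ X) (g' : H₂), (∀ t, (e t, e' t) ∈ p'.F) ∧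
        (g, g') ∈ p'.Γ ⟨X, e, e'⟩ := by
  classical
  obtain ⟨F, hF, hsub, e', he'⟩ := h.base.left.forth_tuple p.F_mem e
  obtain ⟨G, hG, hsub', g', hg'⟩ := h.gadget.left.forth _ (p.Γ_mem ⟨X, e, e'⟩) g
  have hΓ : ∀ k, Function.update p.Γ ⟨X, e, e'⟩ G k ∈ 𝓗 := by
    intro k
    rcases eq_or_ne k ⟨X, e, e'⟩ with rfl | hk
    · rwa [Function.update_self]
    · rw [Function.update_of_ne hk]
      exact p.Γ_mem k
  let p' : Position L σ 𝓑 𝓗 :=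
    { p with F := F, F_mem := hF, Γ := Function.update p.Γ ⟨X, e, e'⟩ G, Γ_mem := hΓ }
  refine ⟨p', fun x y hxy => Position.Rel.mono (p := p) (p' := p') hsub (fun k => ?_) id
      (fun _ => rfl) (fun _ => rfl) (fun _ => subset_rfl) hxy, e', g', he', ?_⟩
  · change p.Γ k ⊆ Function.update p.Γ ⟨X, e, e'⟩ G k
    rcases eq_or_ne k ⟨X, e, e'⟩ with rfl | hk
    · rwa [Function.update_self]
    · rw [Function.update_of_ne hk]
  · change (g, g') ∈ Function.update p.Γ ⟨X, e, e'⟩ G ⟨X, e, e'⟩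
    rwa [Function.update_self]

theorem positionFamily_nonempty (h𝓑 : 𝓑.Nonempty) (h𝓗 : 𝓗.Nonempty) :
    (positionFamily T 𝓑 𝓗 root₁ root₂ base₁ cop₁ base₂ cop₂).Nonempty := by
  obtain ⟨F, hF⟩ := h𝓑
  obtain ⟨G, hG⟩ := h𝓗
  let p : Position L σ 𝓑 𝓗 :=
    { F := F
      F_mem := hF
      Γ := fun _ => G
      Γ_mem := fun _ => hG
      ι := Empty
      finite := inferInstance
      f₁ := fun j => j.elim
      f₂ := fun j => j.elim
      f₁_mem := fun j => j.elim
      f₂_mem := fun j => j.elim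
      f₁_inj := fun {j} => j.elim
      f₂_inj := fun {j} => j.elim
      Δ := fun j => j.elim
      Δ_mem := fun j => j.elim }
  exact ⟨_, p, rfl⟩

end PartsBackForth

variable [L.Structure M₁]

theorem IsDecomposition.cop_of_base {lab : Option (Quotient σ) → H₁ → Prop}
    (D : IsDecomposition T root₁ lab base₁ cop₁) (hl : IsPieceLabelling T root₁ lab)
    {X : Option (Quotient σ)} {e : EdgeTuple σ B₁ X} {t : Fin (classOf σ X).card} {x : M₁}
    (he : e ∈ subedges L σ B₁ X) (h : base₁ (e t.castSucc) x) :
    cop₁ X e (root₁ (classEnum σ X t)) x := by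
  obtain ⟨y, hy⟩ := D.exists_cop he (hl.classEnum X t)
  rwa [D.base_left h (D.base_of_cop hy)]

theorem Position.Rel.exists_base {p : Position L σ 𝓑 𝓗}
    (D : IsDecomposition T root₁ lab₁ base₁ cop₁) {x : M₁} {y : M₂}
    (h : p.Rel T root₁ root₂ base₁ cop₁ base₂ cop₂ x y) {b : B₁} (hb : base₁ b x) :
    ∃ b', (b, b') ∈ p.F ∧ base₂ b' y := by
  cases h with
  | base hF hx hy => exact ⟨_, D.base_right hb hx ▸ hF, hy⟩
  | rooted hF hΓ hn hn' i hr hr' hx hy =>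
    obtain ⟨t, ht, -⟩ := D.root_of_base hb hx
    exact (hn _ ht).elim
  | orphan j hΔ hr hr' hx hy =>
    obtain ⟨t, ht, -⟩ := D.root_of_base hb hx
    exact (hr _ ⟨0, ht.symm⟩).elim

/-- The kinds of pairs exclude each other, and a vertex of a copy that is not a root determines its
gadget vertex, hence its label, hence its subedge. -/
theorem Position.Rel.cases_of_cop {p : Position L σ 𝓑 𝓗}
    (D : IsDecomposition T root₁ lab₁ base₁ cop₁) (hl : IsPieceLabelling T root₁ lab₁)
    {x : M₁} {y : M₂} (hp : p.Rel T root₁ root₂ base₁ cop₁ base₂ cop₂ x y)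
    {X : Option (Quotient σ)} {e : EdgeTuple σ B₁ X} {h : H₁} (hc : cop₁ X e h x) :
    (∃ t, h = root₁ (classEnum σ X t) ∧ ∃ b', (e t.castSucc, b') ∈ p.F ∧ base₂ b' y) ∨
    (∃ e' h', (∀ t, (e t, e' t) ∈ p.F) ∧ (h, h') ∈ p.Γ ⟨X, e, e'⟩ ∧ (∃ i, ReachOn T (root₁ i) h) ∧
      cop₂ X e' h' y) ∨
    (∃ j X' h', e = p.f₁ j X ∧ (h, h') ∈ p.Δ j ∧ (∀ i, ¬ ReachOn T (root₁ i) h) ∧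
      cop₂ X' (p.f₂ j X') h' y) := by
  cases hp with
  | base hF hx hy =>
    obtain ⟨t, rfl, rfl⟩ := D.root_of_base hx hc
    exact Or.inl ⟨t, rfl, _, hF, hy⟩
  | @rooted X' e₁ e' h₁ h' _ _ hF hΓ hn hn' i hr hr' hx hy =>
    obtain rfl := D.vertex_inj hx hc hn
    obtain rfl := hl.unique (D.lab_of_cop hx) (D.lab_of_cop hc)
    obtain rfl := D.edge_inj hx hc hn
    exact Or.inr (Or.inl ⟨e', h', hF, hΓ, ⟨i, hr⟩, hy⟩)
  | @orphan X₁ X' h₁ h' _ _ j hΔ hr hr' hx hy =>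
    have hn : ∀ i, h₁ ≠ root₁ i := fun i hi => hr i ⟨0, hi.symm⟩
    obtain rfl := D.vertex_inj hx hc hn
    obtain rfl := hl.unique (D.lab_of_cop hx) (D.lab_of_cop hc)
    obtain rfl := D.edge_inj hx hc hn
    exact Or.inr (Or.inr ⟨j, X', h', rfl, hΔ, hr, hy⟩)

variable [L.Structure M₂]

namespace PartsBackForth

/-- The kind of the vertex, and then its subedge or its index, single out one partial map, which is
functional by itself. -/
theorem eq_of_rel
    (h : PartsBackForth σ T 𝓑 𝓗 root₁ root₂)
    (D₁ : IsDecomposition T root₁ lab₁ base₁ cop₁) (D₂ : IsDecomposition T root₂ lab₂ base₂ cop₂)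
    (hl₁ : IsPieceLabelling T root₁ lab₁) (hl₂ : IsPieceLabelling T root₂ lab₂)
    {p : Position L σ 𝓑 𝓗} {x x' : M₁} {y y' : M₂}
    (hxy : p.Rel T root₁ root₂ base₁ cop₁ base₂ cop₂ x y)
    (hxy' : p.Rel T root₁ root₂ base₁ cop₁ base₂ cop₂ x' y') (hx : x = x') :
    y = y' := by
  subst hx
  cases hxy with
  | @base b b' _ _ hF hx hy =>
    obtain ⟨b'', hF', hb''⟩ := hxy'.exists_base D₁ hx
    rw [← h.base.left.eq _ p.F_mem hF hF' rfl] at hb''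
    exact D₂.base_left hy hb''
  | @rooted X e e' g g' _ _ hF hΓ hn hn' i hr hr' hx hy =>
    rcases hxy'.cases_of_cop D₁ hl₁ hx with ⟨t, ht, -⟩ | ⟨e'', g'', hF', hΓ', -, hc⟩ |
      ⟨j, X', g'', -, -, hr₂, -⟩
    · exact (hn _ ht).elim
    · obtain rfl : e' = e'' := funext fun t => h.base.left.eq _ p.F_mem (hF t) (hF' t) rfl
      obtain rfl := h.gadget.left.eq _ (p.Γ_mem _) hΓ hΓ' rfl
      exact D₂.cop_left hy hc
    · exact (hr₂ i hr).elim
  | @orphan X X' g g' _ _ j hΔ hr hr' hx hy =>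
    rcases hxy'.cases_of_cop D₁ hl₁ hx with ⟨t, ht, -⟩ | ⟨e'', g'', hF', hΓ', ⟨i, hi⟩, hc⟩ |
      ⟨j', X'', g'', hj, hΔ', -, hc⟩
    · exact (hr _ ⟨0, ht.symm⟩).elim
    · exact (hr i hi).elim
    · obtain rfl := p.f₁_inj hj
      obtain rfl := h.gadget.left.eq _ (p.Δ_mem _) hΔ hΔ' rfl
      obtain rfl := hl₂.unique (D₂.lab_of_cop hy) (D₂.lab_of_cop hc)
      exact D₂.cop_left hy hc

/-- An edge lies in the base or in a single copy. In a copy, adjacency forces either all or none of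
its vertices to be orphans, so one gadget game governs the whole edge. -/
theorem relMap_of_rel
    (h : PartsBackForth σ T 𝓑 𝓗 root₁ root₂)
    (D₁ : IsDecomposition T root₁ lab₁ base₁ cop₁) (D₂ : IsDecomposition T root₂ lab₂ base₂ cop₂)
    (hl₁ : IsPieceLabelling T root₁ lab₁) (hl₂ : IsPieceLabelling T root₂ lab₂)
    {p : Position L σ 𝓑 𝓗} {s : ℕ} (S : L.Relations s) (hS : ⟨s, S⟩ ∈ T)
    (x : Fin s → M₁) (y : Fin s → M₂)
    (hxy : ∀ i, p.Rel T root₁ root₂ base₁ cop₁ base₂ cop₂ (x i) (y i))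
    (hR : Structure.RelMap S x) : Structure.RelMap S y := by
  rcases D₁.rel_cases S hS hR with ⟨b, hb, hbx⟩ | ⟨g, hg, hgx⟩
  · choose b' hF hb' using fun i => (hxy i).exists_base D₁ (hbx i)
    exact D₂.rel_base S hS (h.rel_inl p.F_mem hS hF hb) hb'
  have hadj : ∀ i j, AdjOn T (g i) (g j) := fun i j => ⟨s, S, hS, g, hg, ⟨i, rfl⟩, ⟨j, rfl⟩⟩
  obtain ⟨X, hX⟩ : ∃ X, ∀ i, lab₁ X (g i) := by
    rcases isEmpty_or_nonempty (Fin s) with hs | ⟨⟨i⟩⟩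
    -- An edge of a nullary symbol lies in no particular piece, so any class will do.
    · exact ⟨none, isEmptyElim⟩
    · obtain ⟨X, hX⟩ := hl₁.total (g i)
      exact ⟨X, fun j => hl₁.adj hX (hadj i j)⟩
  obtain ⟨e, he, hc⟩ := hgx X hX
  suffices hmain : (∃ e' ∈ subedges L σ B₂ X, ∃ G ∈ 𝓗,
      ∀ i, ∃ g', (g i, g') ∈ G ∧ cop₂ X e' g' (y i)) ∨
      ∃ i, ∀ i', ¬ ReachOn T (root₁ i') (g i) by
    rcases hmain with ⟨e', he', G, hG, H⟩ | ⟨i₀, hi₀⟩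
    · choose g' hgG hcop using H
      exact D₂.rel_cop S hS (h.gadget.left.rel G hG S hS g g' hgG hg) he' hcop
    · have hr : ∀ i i', ¬ ReachOn T (root₁ i') (g i) := fun i i' hi =>
        hi₀ i' (hi.snoc (hadj i i₀))
      have H : ∀ i, ∃ j X' g', e = p.f₁ j X ∧ (g i, g') ∈ p.Δ j ∧ cop₂ X' (p.f₂ j X') g' (y i) := by
        intro i
        rcases (hxy i).cases_of_cop D₁ hl₁ (hc i) with ⟨t, ht, -⟩ | ⟨_, _, _, _, ⟨i', hi⟩, _⟩ |
          ⟨j, X', g', hj, hΔ, -, hcop⟩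
        · exact (hr i _ ⟨0, ht.symm⟩).elim
        · exact (hr i i' hi).elim
        · exact ⟨j, X', g', hj, hΔ, hcop⟩
      choose j X' g' hj hΔ hcop using H
      have hjj : ∀ i, j i = j i₀ := fun i => p.f₁_inj ((hj i).symm.trans (hj i₀))
      have hg' := h.gadget.left.rel _ (p.Δ_mem (j i₀)) S hS g g' (fun i => hjj i ▸ hΔ i) hg
      -- Orphans on the two sides may have different labels. That the images share a label follows
      -- only after they are known to form an edge.
      have hXX : ∀ i, X' i = X' i₀ := fun i => hl₂.unique (D₂.lab_of_cop (hcop i))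
        (hl₂.adj (D₂.lab_of_cop (hcop i₀)) ⟨s, S, hS, g', hg', ⟨i₀, rfl⟩, ⟨i, rfl⟩⟩)
      refine D₂.rel_cop S hS hg' (p.f₂_mem (j i₀) (X' i₀)) fun i => ?_
      have := hcop i
      rwa [hjj i, hXX i] at this
  by_cases horph : ∃ i, ∀ i', ¬ ReachOn T (root₁ i') (g i)
  · exact Or.inr horph
  refine Or.inl ?_
  push Not at horph
  suffices hF : ∃ F' ∈ 𝓑, p.F ⊆ F' ∧ ∃ e', (∀ t, (e t, e' t) ∈ F') ∧
      ∀ i, (∃ t, g i = root₁ (classEnum σ X t)) ∨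
        ∃ g', (g i, g') ∈ p.Γ ⟨X, e, e'⟩ ∧ cop₂ X e' g' (y i) by
    obtain ⟨F', hF', hsub, e', hee', H⟩ := hF
    have he' := h.map_subedges hF' hee' he
    refine ⟨e', he', _, p.Γ_mem ⟨X, e, e'⟩, fun i => ?_⟩
    rcases H i with ⟨t, ht⟩ | H
    · have hb := hc i
      rw [ht] at hb ⊢
      obtain ⟨b', hbF, hb'⟩ := (hxy i).exists_base D₁ (D₁.base_of_cop hb)
      rw [h.base.left.eq F' hF' (hsub hbF) (hee' _) rfl] at hb'
      exact ⟨_, h.root_mem _ (p.Γ_mem _) _, D₂.cop_of_base hl₂ he' hb'⟩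
    · exact H
  -- A vertex that is not a root already fixes the partner of `e`. If all vertices are roots, the
  -- base game may have to be extended to find one.
  by_cases hroot : ∀ i, ∃ t, g i = root₁ (classEnum σ X t)
  · obtain ⟨F', hF', hsub, e', he'⟩ := h.base.left.forth_tuple p.F_mem e
    exact ⟨F', hF', hsub, e', he', fun i => Or.inl (hroot i)⟩
  · push Not at hroot
    obtain ⟨i₀, hi₀⟩ := hroot
    rcases (hxy i₀).cases_of_cop D₁ hl₁ (hc i₀) with ⟨t, ht, -⟩ | ⟨e', _, hF, _, _, _⟩ |
      ⟨_, _, _, _, _, hr, -⟩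
    · exact (hi₀ t ht).elim
    · refine ⟨p.F, p.F_mem, subset_rfl, e', hF, fun i => ?_⟩
      rcases (hxy i).cases_of_cop D₁ hl₁ (hc i) with ⟨t, ht, -⟩ | ⟨e'', g', hF', hΓ, -, hcop⟩ |
        ⟨_, _, _, _, _, hr, -⟩
      · exact Or.inl ⟨t, ht⟩
      · obtain rfl : e' = e'' := funext fun t => h.base.left.eq _ p.F_mem (hF t) (hF' t) rfl
        exact Or.inr ⟨g', hΓ, hcop⟩
      · obtain ⟨i', hi'⟩ := horph i
        exact (hr i' hi').elim
    · obtain ⟨i', hi'⟩ := horph i₀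
      exact (hr i' hi').elim

theorem exists_rel (h : PartsBackForth σ T 𝓑 𝓗 root₁ root₂)
    (D₁ : IsDecomposition T root₁ lab₁ base₁ cop₁) (D₂ : IsDecomposition T root₂ lab₂ base₂ cop₂)
    (hl₁ : IsPieceLabelling T root₁ lab₁) (hl₂ : IsPieceLabelling T root₂ lab₂)
    (p : Position L σ 𝓑 𝓗) (x : M₁) :
    ∃ p' : Position L σ 𝓑 𝓗,
      (∀ x y, p.Rel T root₁ root₂ base₁ cop₁ base₂ cop₂ x y →
        p'.Rel T root₁ root₂ base₁ cop₁ base₂ cop₂ x y) ∧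
      ∃ y, p'.Rel T root₁ root₂ base₁ cop₁ base₂ cop₂ x y := by
  rcases D₁.cover x with ⟨b, hb⟩ | ⟨g, hg, hc⟩
  · obtain ⟨F, hF, hsub, b', hb'⟩ := h.base.left.forth _ p.F_mem b
    obtain ⟨y, hy⟩ := D₂.exists_base (h.not_aux hF hb' (D₁.not_aux hb))
    let p' : Position L σ 𝓑 𝓗 := { p with F := F, F_mem := hF }
    exact ⟨p', fun x y hxy => Position.Rel.mono (p := p) (p' := p') hsub (fun _ => subset_rfl) id
      (fun _ => rfl) (fun _ => rfl) (fun _ => subset_rfl) hxy, y, .base (p := p') hb' hb hy⟩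
  · obtain ⟨X, hX⟩ := hl₁.total g
    obtain ⟨e, he⟩ := hc X hX
    by_cases hr : ∃ i, ReachOn T (root₁ i) g
    · obtain ⟨i, hr⟩ := hr
      obtain ⟨p', hp', e', g', hF, hΓ⟩ := h.exists_insert_rooted (base₁ := base₁) (cop₁ := cop₁)
        (base₂ := base₂) (cop₂ := cop₂) p e g
      have hr' := h.reach (p'.Γ_mem _) hΓ hr
      -- The root reaching `g` fixes the label of `g`; the corresponding root reaches `g'` and
      -- forces the same label there.
      obtain rfl := hl₁.unique hX (hl₁.reach (hl₁.root i) hr)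
      obtain ⟨y, hy⟩ := D₂.exists_cop (h.map_subedges p'.F_mem hF (D₁.edge_mem he))
        (hl₂.reach (hl₂.root i) hr')
      exact ⟨p', hp', y, .rooted hF hΓ hg (h.ne_root (p'.Γ_mem _) hΓ hg) i hr hr' he hy⟩
    · push Not at hr
      obtain ⟨p', hp', j, g', rfl, hΔ⟩ := h.exists_insert_orphan (base₁ := base₁) (cop₁ := cop₁)
        (base₂ := base₂) (cop₂ := cop₂) p (D₁.edge_mem he) g
      -- The label of `g'` may differ from that of `g`; the matched copy has a subedge of the class
      -- `X'` as well.
      obtain ⟨X', hX'⟩ := hl₂.total g'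
      obtain ⟨y, hy⟩ := D₂.exists_cop (p'.f₂_mem j X') hX'
      exact ⟨p', hp', y, .orphan j hΔ hr (fun i hi => hr i
        (h.symm.reach (swap_mem_swapFamily (p'.Δ_mem j)) hΔ hi)) he hy⟩

theorem isForthSystem (h : PartsBackForth σ T 𝓑 𝓗 root₁ root₂)
    (D₁ : IsDecomposition T root₁ lab₁ base₁ cop₁) (D₂ : IsDecomposition T root₂ lab₂ base₂ cop₂)
    (hl₁ : IsPieceLabelling T root₁ lab₁) (hl₂ : IsPieceLabelling T root₂ lab₂) :
    IsForthSystem T (positionFamily T 𝓑 𝓗 root₁ root₂ base₁ cop₁ base₂ cop₂) where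
  rel := by
    rintro F ⟨p, rfl⟩ s S hS x y hxy hR
    exact h.relMap_of_rel D₁ D₂ hl₁ hl₂ S hS x y hxy hR
  eq := by
    rintro F ⟨p, rfl⟩ x x' y y' hxy hxy' hx
    exact h.eq_of_rel D₁ D₂ hl₁ hl₂ hxy hxy' hx
  forth := by
    rintro F ⟨p, rfl⟩ x
    obtain ⟨p', hp', y, hy⟩ := h.exists_rel D₁ D₂ hl₁ hl₂ p x
    exact ⟨_, ⟨p', rfl⟩, fun z hz => hp' _ _ hz, y, hy⟩

/-- If the parts of two decomposed structures are back-and-forth equivalent, then so are these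
structures. -/
theorem isBackForthSystem (h : PartsBackForth σ T 𝓑 𝓗 root₁ root₂)
    (D₁ : IsDecomposition T root₁ lab₁ base₁ cop₁) (D₂ : IsDecomposition T root₂ lab₂ base₂ cop₂)
    (hl₁ : IsPieceLabelling T root₁ lab₁) (hl₂ : IsPieceLabelling T root₂ lab₂) :
    IsBackForthSystem T (positionFamily T 𝓑 𝓗 root₁ root₂ base₁ cop₁ base₂ cop₂) := by
  refine ⟨h.isForthSystem D₁ D₂ hl₁ hl₂, ?_⟩
  rw [swapFamily_positionFamily]
  exact h.symm.isForthSystem D₂ D₁ hl₂ hl₁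

end PartsBackForth

end Decomposition

/-! ### Ultraproducts of decomposed structures -/

/-- An ultrafilter selects one of finitely many cases; used for classes of `σ` and for positions in
a subedge. -/
theorem Ultrafilter.exists_eventually_of_eventually_exists {ι : Type*} [Finite ι] {α : Type*}
    {U : Ultrafilter α} {P : α → ι → Prop} (h : ∀ᶠ n in U, ∃ i, P n i) : ∃ i, ∀ᶠ n in U, P n i := by
  by_contra hc
  simp only [not_exists, ← Ultrafilter.eventually_not] at hc
  obtain ⟨n, ⟨i, hi⟩, hn⟩ := (h.and (eventually_all.2 hc)).exists
  exact hn i hi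

namespace UProd

variable {L : FirstOrder.Language.{u, v}} {r : ℕ} {σ : Setoid (Fin r)} {U : Ultrafilter ℕ}
  {B : ℕ → Type w} {M : ℕ → Type w'} {H : ℕ → Type w₁}

theorem ne_mk {a : UProd U M} {f : ∀ n, M n} (h : a ≠ mk f) : ∀ᶠ n in U, a.out n ≠ f n := by
  rw [Ne, eq_iff, ← Ultrafilter.eventually_not] at h
  filter_upwards [h, out_mk f] with n hn hf
  rwa [hf] at hn

section Frag

variable [∀ n, (fragLanguage L σ).Structure (B n)]

theorem mem_subedges_iff {X : Option (Quotient σ)} {e : EdgeTuple σ (UProd U B) X} :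
    e ∈ subedges L σ (UProd U B) X ↔
      ∀ᶠ n in U, (fun t => (e t).out n) ∈ subedges L σ (B n) X :=
  relMap_iff (L := fragLanguage L σ) (Sum.inr (FragRel.sub X)) e

theorem isAuxiliary_iff [UniformlyNonempty B] {b : UProd U B} :
    IsAuxiliary L σ b ↔ ∀ᶠ n in U, IsAuxiliary L σ (b.out n) := by
  constructor
  · rintro ⟨X, e, he, rfl⟩
    exact (mem_subedges_iff.1 he).mono fun n hn => ⟨X, _, hn, rfl⟩
  · intro h
    obtain ⟨X, hX⟩ := Ultrafilter.exists_eventually_of_eventually_exists h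
    obtain ⟨e, he⟩ := exists_tuple_of_eventually hX
    exact ⟨X, e, mem_subedges_iff.2 (he.mono fun n hn => hn.1),
      eq_iff.2 (he.mono fun n hn => hn.2)⟩

theorem not_isAuxiliary_iff [UniformlyNonempty B] {b : UProd U B} :
    ¬ IsAuxiliary L σ b ↔ ∀ᶠ n in U, ¬ IsAuxiliary L σ (b.out n) := by
  rw [isAuxiliary_iff, Ultrafilter.eventually_not]

end Frag

/-- The relation of base vertices in an ultraproduct. -/
def base (base : ∀ n, B n → M n → Prop) (b : UProd U B) (m : UProd U M) : Prop :=
  ∀ᶠ n in U, base n (b.out n) (m.out n)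

/-- The relation of vertices in copies in an ultraproduct. -/
def cop (cop : ∀ n X, EdgeTuple σ (B n) X → H n → M n → Prop) (X : Option (Quotient σ))
    (e : EdgeTuple σ (UProd U B) X) (h : UProd U H) (m : UProd U M) : Prop :=
  ∀ᶠ n in U, cop n X (fun t => (e t).out n) (h.out n) (m.out n)

/-- The labelling of an ultraproduct. -/
def lab (lab : ∀ n, Option (Quotient σ) → H n → Prop) (X : Option (Quotient σ))
    (h : UProd U H) : Prop :=
  ∀ᶠ n in U, lab n X (h.out n)

/-- The roots of an ultraproduct. -/
def root (root : ∀ n, Fin r → H n) (i : Fin r) : UProd U H := mk fun n => root n i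

theorem out_root (root : ∀ n, Fin r → H n) :
    ∀ᶠ n in U, ∀ i, (UProd.root root i : UProd U H).out n = root n i :=
  eventually_all.2 fun _ => out_mk _

variable [∀ n, (fragLanguage L σ).Structure (B n)] [∀ n, L.Structure (M n)] [∀ n, L.Structure (H n)]
  {T : Set (Σ n, L.Relations n)} {rt : ∀ n, Fin r → H n}
  {lb : ∀ n, Option (Quotient σ) → H n → Prop} {bs : ∀ n, B n → M n → Prop}
  {cp : ∀ n X, EdgeTuple σ (B n) X → H n → M n → Prop}

/-- Every axiom is checked coordinatewise: existential witnesses are glued, and the disjunctions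
involved are finite. -/
theorem isDecomposition [UniformlyNonempty B] [UniformlyNonempty M] [UniformlyNonempty H]
    (D : ∀ n, IsDecomposition T (rt n) (lb n) (bs n) (cp n)) :
    IsDecomposition (B := UProd U B) (M := UProd U M) (H := UProd U H) T (root rt) (lab lb)
      (base bs) (cop cp) where
  cover m := by
    rcases Ultrafilter.eventually_or.1 (Eventually.of_forall (f := (U : Filter ℕ))
      fun n => (D n).cover (m.out n)) with h | h
    · exact Or.inl (exists_of_eventually h)
    · obtain ⟨h, hh⟩ := exists_of_eventually h
      refine Or.inr ⟨h, fun i hi => ?_, fun X hX => ?_⟩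
      · obtain ⟨n, h1, h2, h3⟩ := (hh.and ((eq_iff.1 hi).and (out_root rt))).exists
        exact h1.1 i (h2.trans (h3 i))
      · exact exists_tuple_of_eventually
          (Q := fun n e => cp n X e (h.out n) (m.out n)) (by
            filter_upwards [hh, hX] with n h1 h2
            exact h1.2 X h2)
  not_aux h := not_isAuxiliary_iff.2 (h.mono fun n hn => (D n).not_aux hn)
  exists_base h := exists_of_eventually
    ((not_isAuxiliary_iff.1 h).mono fun n hn => (D n).exists_base hn)
  base_left h h' := eq_iff.2 ((h.and h').mono fun n hn => (D n).base_left hn.1 hn.2)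
  base_right h h' := eq_iff.2 ((h.and h').mono fun n hn => (D n).base_right hn.1 hn.2)
  edge_mem h := mem_subedges_iff.2 (h.mono fun n hn => (D n).edge_mem hn)
  lab_of_cop h := h.mono fun n hn => (D n).lab_of_cop hn
  exists_cop he h := exists_of_eventually
    (((mem_subedges_iff.1 he).and h).mono fun n hn => (D n).exists_cop hn.1 hn.2)
  cop_left h h' := eq_iff.2 ((h.and h').mono fun n hn => (D n).cop_left hn.1 hn.2)
  edge_inj h h' hn := by
    refine funext fun t => eq_iff.2 ?_
    filter_upwards [h, h', eventually_all.2 fun i => ne_mk (hn i)] with n h1 h2 h3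
    exact congrFun ((D n).edge_inj h1 h2 h3) t
  vertex_inj h h' hn := by
    refine eq_iff.2 ?_
    filter_upwards [h, h', eventually_all.2 fun i => ne_mk (hn i)] with n h1 h2 h3
    exact (D n).vertex_inj h1 h2 h3
  base_of_cop h := by
    filter_upwards [h, out_root rt] with n h1 h2
    rw [h2] at h1
    exact (D n).base_of_cop h1
  root_of_base h h' := by
    obtain ⟨t, ht⟩ := Ultrafilter.exists_eventually_of_eventually_exists
      ((h.and h').mono fun n hn => (D n).root_of_base hn.1 hn.2)
    refine ⟨t, eq_iff.2 ?_, eq_iff.2 (ht.mono fun n hn => hn.2)⟩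
    filter_upwards [ht, out_root rt] with n h1 h2
    rw [h1.1, h2]
  rel_base S hS b x hb h := by
    rw [relMap_iff]
    filter_upwards [(relMap_iff (L := fragLanguage L σ) _ b).1 hb, eventually_all.2 h] with n h1 h2
    exact (D n).rel_base S hS h1 h2
  rel_cop S hS X e h x hb he hc := by
    rw [relMap_iff] at hb ⊢
    filter_upwards [hb, mem_subedges_iff.1 he, eventually_all.2 hc] with n h1 h2 h3
    exact (D n).rel_cop S hS h1 h2 h3
  rel_cases S hS x hx := by
    rw [relMap_iff] at hx
    rcases Ultrafilter.eventually_or.1 (hx.mono fun n hn => (D n).rel_cases S hS hn) with h | h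
    · obtain ⟨b, hb⟩ := exists_tuple_of_eventually h
      exact Or.inl ⟨b, (relMap_iff (L := fragLanguage L σ) _ _).2 (hb.mono fun n hn => hn.1),
        eventually_all.1 (hb.mono fun n hn => hn.2)⟩
    · obtain ⟨h, hh⟩ := exists_tuple_of_eventually h
      refine Or.inr ⟨h, (relMap_iff _ _).2 (hh.mono fun n hn => hn.1), fun X hX => ?_⟩
      obtain ⟨e, he⟩ := exists_tuple_of_eventually (Q := fun n e => e ∈ subedges L σ (B n) X ∧
        ∀ i, cp n X e ((h i).out n) ((x i).out n)) (by
          filter_upwards [hh, eventually_all.2 hX] with n h1 h2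
          exact h1.2 X h2)
      exact ⟨e, mem_subedges_iff.2 (he.mono fun n hn => hn.1),
        eventually_all.1 (he.mono fun n hn => hn.2)⟩

theorem isPieceLabelling (hl : ∀ n, IsPieceLabelling T (rt n) (lb n)) :
    IsPieceLabelling (H := UProd U H) T (root rt) (lab lb) where
  total h := Ultrafilter.exists_eventually_of_eventually_exists
    (Eventually.of_forall fun n => (hl n).total (h.out n))
  unique h h' := by
    obtain ⟨n, hn⟩ := (h.and h').exists
    exact (hl n).unique hn.1 hn.2
  root i := by
    filter_upwards [out_root rt] with n hn
    rw [hn]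
    exact (hl n).root i
  adj := by
    rintro X _ _ h ⟨s, S, hS, a, ha, ⟨i, rfl⟩, ⟨j, rfl⟩⟩
    filter_upwards [h, (relMap_iff S a).1 ha] with n h1 h2
    exact (hl n).adj h1 ⟨s, S, hS, _, h2, ⟨i, rfl⟩, ⟨j, rfl⟩⟩

end UProd

/-! ### Labellings of gadget vertices -/

section Relabel

variable {L : FirstOrder.Language.{u, v}} {r : ℕ} {σ : Setoid (Fin r)}
  {T : Set (Σ n, L.Relations n)}
  {B : Type w} {M : Type w'} {H : Type w₁} [(fragLanguage L σ).Structure B] [L.Structure M]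
  [L.Structure H] {root : Fin r → H} {base : B → M → Prop}
  {cop : ∀ X, EdgeTuple σ B X → H → M → Prop}

/-- The copies of a decomposition may be restricted to the vertices with certain labels. -/
theorem IsDecomposition.relabel {lab lab' : Option (Quotient σ) → H → Prop}
    (D : IsDecomposition T root lab base cop) (hle : ∀ {X h}, lab' X h → lab X h) :
    IsDecomposition T root lab' base (fun X e h m => cop X e h m ∧ lab' X h) where
  cover m := (D.cover m).imp_right fun ⟨h, hn, hc⟩ =>
    ⟨h, hn, fun X hX => (hc X (hle hX)).imp fun _ he => ⟨he, hX⟩⟩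
  not_aux := D.not_aux
  exists_base := D.exists_base
  base_left := D.base_left
  base_right := D.base_right
  edge_mem h := D.edge_mem h.1
  lab_of_cop h := h.2
  exists_cop he h := (D.exists_cop he (hle h)).imp fun _ hm => ⟨hm, h⟩
  cop_left h h' := D.cop_left h.1 h'.1
  edge_inj h h' := D.edge_inj h.1 h'.1
  vertex_inj h h' := D.vertex_inj h.1 h'.1
  base_of_cop h := D.base_of_cop h.1
  root_of_base h h' := D.root_of_base h h'.1
  rel_base := D.rel_base
  rel_cop S hS _ _ _ _ hR he hc := D.rel_cop S hS hR he fun i => (hc i).1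
  rel_cases S hS _ hx := (D.rel_cases S hS hx).imp_right fun ⟨h, hR, hc⟩ =>
    ⟨h, hR, fun X hX => (hc X fun i => hle (hX i)).imp fun _ he =>
      ⟨he.1, fun i => ⟨he.2 i, hX i⟩⟩⟩

/-- The labelling that restricts the labels of the roots only. -/
def rootLabel (root : Fin r → H) (X : Option (Quotient σ)) (h : H) : Prop :=
  ∀ i, h = root i → X = some (Quotient.mk σ i)

theorem IsPieceLabelling.rootLabel {lab : Option (Quotient σ) → H → Prop}
    (hl : IsPieceLabelling T root lab) {X : Option (Quotient σ)} {h : H} (hX : lab X h) :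
    rootLabel root X h := by
  rintro i rfl
  exact hl.unique hX (hl.root i)

/-- An element different from a root differs from it in almost all coordinates, and there are
finitely many roots. -/
theorem UProd.lab_rootLabel {U : Ultrafilter ℕ} {H : ℕ → Type w₁} {rt : ∀ n, Fin r → H n}
    {X : Option (Quotient σ)} {h : UProd U H} (hX : _root_.rootLabel (UProd.root rt) X h) :
    UProd.lab (fun n => _root_.rootLabel (rt n)) X h := by
  refine eventually_all.2 fun i => ?_
  by_cases hi : h = UProd.root rt i
  · exact Eventually.of_forall fun _ _ => hX i hi
  · exact (ne_mk hi).mono fun n hn hn' => (hn hn').elim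

/-- The labelling of the vertices by the class of the roots in their component. -/
def componentLabel (T : Set (Σ n, L.Relations n)) (root : Fin r → H) :
    Option (Quotient σ) → H → Prop
  | none, h => ∀ i, ¬ ReachOn T (root i) h
  | some q, h => ∃ i, Quotient.mk σ i = q ∧ ReachOn T (root i) h

/-- All roots that reach a given vertex reach each other, so by `hsep` they lie in one class. -/
theorem isPieceLabelling_componentLabel
    (hsep : ∀ i j, ReachOn T (root i) (root j) → σ i j) :
    IsPieceLabelling (σ := σ) T root (componentLabel T root) where
  total h := by
    by_cases hr : ∃ i, ReachOn T (root i) h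
    · obtain ⟨i, hi⟩ := hr
      exact ⟨some (Quotient.mk σ i), i, rfl, hi⟩
    · exact ⟨none, not_exists.1 hr⟩
  unique {X X'} h hX hX' := by
    rcases X with _ | q <;> rcases X' with _ | q'
    · rfl
    · obtain ⟨i, -, hi⟩ := hX'
      exact (hX i hi).elim
    · obtain ⟨i, -, hi⟩ := hX
      exact (hX' i hi).elim
    · obtain ⟨i, rfl, hi⟩ := hX
      obtain ⟨j, rfl, hj⟩ := hX'
      exact congrArg some (Quotient.sound (hsep i j (hi.trans hj.symm)))
  root i := ⟨i, rfl, 0, rfl⟩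
  adj {X h h'} hX ha := by
    rcases X with _ | q
    · exact fun i hi => hX i (hi.snoc ha.symm)
    · obtain ⟨i, hq, hi⟩ := hX
      exact ⟨i, hq, hi.snoc ha⟩

end Relabel

/-! ### The gadget construction as a decomposed structure -/

namespace GadgetStar

section NormalForm

variable {L : FirstOrder.Language.{u, v}} {r : ℕ} {A : BaseStructure.{u, v, w} L r}
  {G : Gadget.{u, v, w'} L r}

/-- The vertex of the gadget construction given by a vertex of the base structure. -/
def inl (a : A.V) : GadgetStar A G := Quot.mk _ (Sum.inl a)

/-- The vertex of the gadget construction given by a vertex of a copy of the gadget. -/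
def inr (e : A.R) (g : G.V) : GadgetStar A G := Quot.mk _ (Sum.inr (e, g))

theorem inr_root (e : A.R) (i : Fin r) : (inr e (G.root i) : GadgetStar A G) = inl (e.1 i) :=
  (Quot.sound (GadgetStarGlue.glue e i)).symm

open Classical in
/-- The canonical representative of a vertex of the gadget construction. -/
noncomputable def normalize : A.V ⊕ (A.R × G.V) → A.V ⊕ (A.R × G.V)
  | Sum.inl a => Sum.inl a
  | Sum.inr (e, g) => if h : ∃ i, g = G.root i then Sum.inl (e.1 h.choose) else Sum.inr (e, g)

theorem normalize_root (e : A.R) (i : Fin r) :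
    normalize (A := A) (G := G) (Sum.inr (e, G.root i)) = Sum.inl (e.1 i) := by
  have h : ∃ j, G.root i = G.root j := ⟨i, rfl⟩
  simp only [normalize, dif_pos h]
  rw [← G.root_injective h.choose_spec]

theorem normalize_of_ne {e : A.R} {g : G.V} (h : ∀ i, g ≠ G.root i) :
    normalize (A := A) (G := G) (Sum.inr (e, g)) = Sum.inr (e, g) := by
  simp only [normalize]
  rw [dif_neg (by simpa using h)]

/-- `normalize` respects the generating pairs and so factors through the quotient; identified
vertices are recognized by comparing normal forms. -/
theorem normalize_eq_of_mk_eq {x y : A.V ⊕ (A.R × G.V)}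
    (h : (Quot.mk _ x : GadgetStar A G) = Quot.mk _ y) : normalize x = normalize y := by
  refine congrArg (Quot.lift (r := GadgetStarGlue A G) normalize ?_) h
  rintro _ _ ⟨e, i⟩
  rw [normalize_root]
  rfl

theorem inl_injective : Function.Injective (inl : A.V → GadgetStar A G) :=
  fun _ _ h => Sum.inl_injective (normalize_eq_of_mk_eq h)

theorem exists_root_of_inl_eq_inr {a : A.V} {e : A.R} {g : G.V}
    (h : (inl a : GadgetStar A G) = inr e g) : ∃ i, g = G.root i ∧ e.1 i = a := by
  by_cases hg : ∃ i, g = G.root i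
  · obtain ⟨i, rfl⟩ := hg
    rw [inr_root] at h
    exact ⟨i, rfl, (inl_injective h).symm⟩
  · have := normalize_eq_of_mk_eq h
    rw [normalize_of_ne (not_exists.1 hg)] at this
    exact (Sum.inl_ne_inr this).elim

theorem inr_inj {e e' : A.R} {g g' : G.V} (h : (inr e g : GadgetStar A G) = inr e' g')
    (hg : ∀ i, g ≠ G.root i) : e = e' ∧ g = g' := by
  by_cases hg' : ∃ i, g' = G.root i
  · obtain ⟨i, rfl⟩ := hg'
    rw [inr_root] at h
    obtain ⟨j, hj, -⟩ := exists_root_of_inl_eq_inr h.symm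
    exact (hg j hj).elim
  · have := normalize_eq_of_mk_eq h
    rw [normalize_of_ne hg, normalize_of_ne (not_exists.1 hg')] at this
    exact Prod.mk.inj (Sum.inr_injective this)

theorem cases_mk (m : GadgetStar A G) :
    (∃ a, m = inl a) ∨ ∃ e g, (∀ i, g ≠ G.root i) ∧ m = inr e g := by
  obtain ⟨a | ⟨e, g⟩⟩ := m
  · exact Or.inl ⟨a, rfl⟩
  · by_cases hg : ∃ i, g = G.root i
    · obtain ⟨i, rfl⟩ := hg
      exact Or.inl ⟨e.1 i, inr_root e i⟩
    · exact Or.inr ⟨e, g, not_exists.1 hg, rfl⟩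

end NormalForm

end GadgetStar

/-! ### Vertices and subedges of a fragmented base structure -/

namespace Fragmented

variable {L : FirstOrder.Language.{u, v}} [L.IsRelational] {r : ℕ} {σ : Setoid (Fin r)}
  {A : BaseStructure.{u, v, w} L r}

/-- The vertex of a fragmented base structure given by a vertex of the base structure. -/
def vertex (σ : Setoid (Fin r)) (a : A.V) : Fragmented A σ :=
  GadgetStar.inl (A := A.toFragLanguage σ) (G := Gad L σ) a

/-- The auxiliary vertices of a fragmented base structure. -/
def aux (e : A.R) (X : Option (Quotient σ)) : Fragmented A σ :=
  GadgetStar.inr (A := A.toFragLanguage σ) (G := Gad L σ) e (Sum.inr X)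

/-- The subedge of the class `X` that arises from an edge. -/
noncomputable def subedge (X : Option (Quotient σ)) (e : A.R) : EdgeTuple σ (Fragmented A σ) X :=
  Fin.snoc (α := fun _ => Fragmented A σ) (fun j => vertex σ (e.1 (classEnum σ X j))) (aux e X)

theorem subedge_castSucc (X : Option (Quotient σ)) (e : A.R) (t : Fin (classOf σ X).card) :
    subedge X e t.castSucc = vertex σ (e.1 (classEnum σ X t)) :=
  Fin.snoc_castSucc ..

theorem subedge_last (X : Option (Quotient σ)) (e : A.R) : subedge X e (Fin.last _) = aux e X :=
  Fin.snoc_last ..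

theorem vertex_injective : Function.Injective (vertex σ : A.V → Fragmented A σ) :=
  fun _ _ h => GadgetStar.inl_injective (A := A.toFragLanguage σ) h

theorem inr_ne_root (X : Option (Quotient σ)) (i : Fin r) :
    (Sum.inr X : (Gad L σ).V) ≠ (Gad L σ).root i := Sum.inr_ne_inl

theorem vertex_ne_aux (a : A.V) (e : A.R) (X : Option (Quotient σ)) : vertex σ a ≠ aux e X := by
  intro h
  obtain ⟨i, hi, -⟩ := GadgetStar.exists_root_of_inl_eq_inr (A := A.toFragLanguage σ) h
  exact inr_ne_root X i hi

theorem aux_inj {e e' : A.R} {X X' : Option (Quotient σ)} (h : aux e X = aux e' X') : e = e' :=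
  (GadgetStar.inr_inj (A := A.toFragLanguage σ) h (inr_ne_root X)).1

/-- The auxiliary vertex remembers the edge, even when the class is empty or other edges share the
same vertices of the class. -/
theorem subedge_injective (X : Option (Quotient σ)) :
    Function.Injective (subedge X : A.R → EdgeTuple σ (Fragmented A σ) X) := fun e e' h =>
  aux_inj (X := X) (X' := X) (by rw [← subedge_last, ← subedge_last, h])

theorem mem_subedges_iff {X : Option (Quotient σ)} {e : EdgeTuple σ (Fragmented A σ) X} :
    e ∈ subedges L σ (Fragmented A σ) X ↔ ∃ e₀, e = subedge X e₀ := by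
  have key : ∀ e₀ : A.R, subedge X e₀ = fun i => (Quot.mk _ (Sum.inr (e₀,
      (Fin.snoc (α := fun _ => Fin r ⊕ Option (Quotient σ))
        (fun j => Sum.inl (classEnum σ X j)) (Sum.inr X) : Fin _ → _) i)) : Fragmented A σ) := by
    intro e₀
    funext i
    induction i using Fin.lastCases with
    | last => rw [subedge_last, Fin.snoc_last]; rfl
    | cast i =>
      rw [subedge_castSucc, Fin.snoc_castSucc]
      exact (GadgetStar.inr_root (A := A.toFragLanguage σ) (G := Gad L σ) e₀ _).symm
  constructor
  · rintro (⟨a, ha, -⟩ | ⟨e₀, b, hb, rfl⟩)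
    -- The base structure has no edges of the added symbols, so all subedges come from copies of
    -- `Gad L σ`.
    · exact ha.elim
    · cases (hb : b = _)
      exact ⟨e₀, (key e₀).symm⟩
  · rintro ⟨e₀, rfl⟩
    exact Or.inr ⟨e₀, _, rfl, key e₀⟩

theorem relMap_inl_iff {s : ℕ} {S : L.Relations s} {b : Fin s → Fragmented A σ} :
    Structure.RelMap (L := fragLanguage L σ) (Sum.inl S) b ↔
      ∃ a : Fin s → A.V, Structure.RelMap S a ∧ b = fun i => vertex σ (a i) := by
  constructor
  · rintro (⟨a, ha, h⟩ | ⟨e₀, b, hb, -⟩)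
    · exact ⟨a, ha, h⟩
    · exact hb.elim
  · rintro ⟨a, ha, h⟩
    exact Or.inl ⟨a, ha, h⟩

theorem not_isAuxiliary_iff {b : Fragmented A σ} :
    ¬ IsAuxiliary L σ b ↔ ∃ a, b = vertex σ a := by
  constructor
  · intro h
    rcases GadgetStar.cases_mk (A := A.toFragLanguage σ) b with ⟨a, ha⟩ | ⟨e, g, hg, rfl⟩
    · exact ⟨a, ha⟩
    · rcases g with i | X
      · exact (hg i rfl).elim
      · exact (h ⟨X, subedge X e, mem_subedges_iff.2 ⟨e, rfl⟩, subedge_last (A := A) X e⟩).elim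
  · rintro ⟨a, rfl⟩ ⟨X, e, he, h⟩
    obtain ⟨e₀, rfl⟩ := mem_subedges_iff.1 he
    rw [subedge_last] at h
    exact vertex_ne_aux _ _ _ h.symm

end Fragmented

namespace GadgetStar

variable {L : FirstOrder.Language.{u, v}} [L.IsRelational] {r : ℕ}

/-- The relation of base vertices in the gadget construction. -/
def base (σ : Setoid (Fin r)) (A : BaseStructure.{u, v, w} L r) (G : Gadget.{u, v, w'} L r)
    (b : Fragmented A σ) (m : GadgetStar A G) : Prop :=
  ∃ a, b = Fragmented.vertex σ a ∧ m = inl a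

/-- The relation of vertices in copies in the gadget construction. -/
def cop (σ : Setoid (Fin r)) (A : BaseStructure.{u, v, w} L r) (G : Gadget.{u, v, w'} L r)
    (X : Option (Quotient σ)) (e : EdgeTuple σ (Fragmented A σ) X) (h : G.V)
    (m : GadgetStar A G) : Prop :=
  (∃ e₀, e = Fragmented.subedge X e₀ ∧ m = inr e₀ h) ∧ rootLabel G.root X h

/-- A single gadget may connect roots of different classes, so here a vertex other than a root is
allowed in the copy over each subedge of its edge. Only roots are tied to their class, as
`root_of_base` requires. The labels are refined after passing to the ultraproduct. -/
theorem isDecomposition (T : Set (Σ n, L.Relations n)) (σ : Setoid (Fin r))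
    (A : BaseStructure.{u, v, w} L r) (G : Gadget.{u, v, w'} L r) :
    IsDecomposition T G.root (rootLabel G.root) (base σ A G) (cop σ A G) where
  cover m := by
    rcases cases_mk m with ⟨a, rfl⟩ | ⟨e, g, hg, rfl⟩
    · exact Or.inl ⟨_, a, rfl, rfl⟩
    · exact Or.inr ⟨g, hg, fun X hX => ⟨_, ⟨e, rfl, rfl⟩, hX⟩⟩
  not_aux := fun ⟨a, h, _⟩ => Fragmented.not_isAuxiliary_iff.2 ⟨a, h⟩
  exists_base h :=
    let ⟨a, ha⟩ := Fragmented.not_isAuxiliary_iff.1 h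
    ⟨_, a, ha, rfl⟩
  base_left := by
    rintro _ _ _ ⟨a, rfl, rfl⟩ ⟨a', h, rfl⟩
    rw [Fragmented.vertex_injective h]
  base_right := by
    rintro _ _ _ ⟨a, rfl, rfl⟩ ⟨a', rfl, h⟩
    rw [inl_injective h]
  edge_mem := fun ⟨⟨e₀, h, _⟩, _⟩ => Fragmented.mem_subedges_iff.2 ⟨e₀, h⟩
  lab_of_cop h := h.2
  exists_cop he hX :=
    let ⟨e₀, h⟩ := Fragmented.mem_subedges_iff.1 he
    ⟨_, ⟨e₀, h, rfl⟩, hX⟩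
  cop_left := by
    rintro X _ _ _ _ ⟨⟨e₀, rfl, rfl⟩, -⟩ ⟨⟨e₁, h, rfl⟩, -⟩
    rw [Fragmented.subedge_injective X h]
  edge_inj := by
    rintro X _ _ _ _ _ ⟨⟨e₀, rfl, rfl⟩, -⟩ ⟨⟨e₁, rfl, h⟩, -⟩ hn
    rw [(inr_inj h hn).1]
  vertex_inj := by
    rintro X X' _ _ _ _ _ ⟨⟨e₀, rfl, rfl⟩, -⟩ ⟨⟨e₁, rfl, h⟩, -⟩ hn
    exact (inr_inj h hn).2
  base_of_cop := by
    rintro X _ t _ ⟨⟨e₀, rfl, rfl⟩, -⟩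
    exact ⟨_, Fragmented.subedge_castSucc X e₀ t, inr_root _ _⟩
  root_of_base := by
    rintro X _ _ _ _ ⟨a, rfl, rfl⟩ ⟨⟨e₀, rfl, h⟩, hX⟩
    obtain ⟨i, rfl, rfl⟩ := exists_root_of_inl_eq_inr h
    obtain rfl := hX i rfl
    obtain ⟨t, ht⟩ := exists_classEnum_eq σ i
    exact ⟨t, by rw [ht], by rw [Fragmented.subedge_castSucc, ht]⟩
  rel_base := by
    rintro s S - _ x hb hx
    obtain ⟨a, ha, rfl⟩ := Fragmented.relMap_inl_iff.1 hb
    refine Or.inl ⟨a, ha, funext fun i => ?_⟩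
    obtain ⟨a', h, h'⟩ := hx i
    rw [h', Fragmented.vertex_injective h]
    rfl
  rel_cop := by
    rintro s S - X e h x hR he hx
    obtain ⟨e₀, rfl⟩ := Fragmented.mem_subedges_iff.1 he
    refine Or.inr ⟨e₀, h, hR, funext fun i => ?_⟩
    obtain ⟨⟨e₁, h, h'⟩, -⟩ := hx i
    rw [h', Fragmented.subedge_injective X h]
    rfl
  rel_cases := by
    rintro s S - x (⟨a, ha, rfl⟩ | ⟨e₀, b, hb, rfl⟩)
    · exact Or.inl ⟨_, Fragmented.relMap_inl_iff.2 ⟨a, ha, rfl⟩, fun i => ⟨a i, rfl, rfl⟩⟩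
    · exact Or.inr ⟨b, hb, fun X hX => ⟨_, Fragmented.mem_subedges_iff.2 ⟨e₀, rfl⟩, fun i =>
        ⟨⟨e₀, rfl, rfl⟩, hX i⟩⟩⟩

end GadgetStar

/-! ### The construction `*_σ` as a decomposed structure -/

namespace FragStar

variable {L : FirstOrder.Language.{u, v}} {r : ℕ} {σ : Setoid (Fin r)} {B : Type w}
  [(fragLanguage L σ).Structure B] {H : Gadget.{u, v, w'} L r}

theorem isPieceLabelling (T : Set (Σ n, L.Relations n))
    (hsep : ∀ i j, (gaifmanGraph L H.V).Reachable (H.root i) (H.root j) → σ i j) :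
    IsPieceLabelling T H.root (H.piece σ) where
  total h := by
    by_cases hr : ∃ i, (gaifmanGraph L H.V).Reachable (H.root i) h
    · obtain ⟨i, hi⟩ := hr
      exact ⟨some (Quotient.mk σ i), i, rfl, hi⟩
    · exact ⟨none, not_exists.1 hr⟩
  unique {X X'} h hX hX' := by
    rcases X with _ | q <;> rcases X' with _ | q'
    · rfl
    · obtain ⟨i, -, hi⟩ := hX'
      exact (hX i hi).elim
    · obtain ⟨i, -, hi⟩ := hX
      exact (hX' i hi).elim
    · obtain ⟨i, rfl, hi⟩ := hX
      obtain ⟨j, rfl, hj⟩ := hX'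
      exact congrArg some (Quotient.sound (hsep i j (hi.trans hj.symm)))
  root i := ⟨i, rfl, SimpleGraph.Reachable.rfl⟩
  adj {X h h'} hX ha := by
    have hr : (gaifmanGraph L H.V).Reachable h h' := WalkOn.reachable (d := 1) ⟨h', ha, rfl⟩
    rcases X with _ | q
    · exact fun i hi => hX i (hi.trans hr.symm)
    · obtain ⟨i, hq, hi⟩ := hX
      exact ⟨i, hq, hi.trans hr⟩

open Classical in
/-- The canonical representative of a vertex. -/
noncomputable def normalize
    (hgood : ∀ X, ∀ e ∈ subedges L σ B X, ∀ t : Fin (classOf σ X).card,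
      ¬ IsAuxiliary L σ (e t.castSucc)) : PreFragStar σ B H → PreFragStar σ B H
  | Sum.inl b => Sum.inl b
  | Sum.inr ⟨X, e, h⟩ => if hr : ∃ t, h.1 = H.root (classEnum σ X t) then
      Sum.inl ⟨e.1 hr.choose.castSucc, hgood X e.1 e.2 _⟩ else Sum.inr ⟨X, e, h⟩

theorem classEnum_injective (X : Option (Quotient σ)) : Function.Injective (classEnum σ X) :=
  ((classOf σ X).orderEmbOfFin rfl).injective

section

variable (hgood : ∀ X, ∀ e ∈ subedges L σ B X, ∀ t : Fin (classOf σ X).card,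
  ¬ IsAuxiliary L σ (e t.castSucc))

theorem normalize_root {X : Option (Quotient σ)} (e : subedges L σ B X) {h : H.piece σ X}
    {t : Fin (classOf σ X).card} (ht : h.1 = H.root (classEnum σ X t)) :
    normalize (H := H) hgood (Sum.inr ⟨X, e, h⟩) =
      Sum.inl ⟨e.1 t.castSucc, hgood X e.1 e.2 t⟩ := by
  have hr : ∃ t, h.1 = H.root (classEnum σ X t) := ⟨t, ht⟩
  simp only [normalize, dif_pos hr]
  have : hr.choose = t :=
    classEnum_injective X (H.root_injective (hr.choose_spec.symm.trans ht))
  simp only [this]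

theorem normalize_of_ne {X : Option (Quotient σ)} (e : subedges L σ B X) {h : H.piece σ X}
    (hn : ∀ t, h.1 ≠ H.root (classEnum σ X t)) :
    normalize (H := H) hgood (Sum.inr ⟨X, e, h⟩) = Sum.inr ⟨X, e, h⟩ := by
  simp only [normalize]
  rw [dif_neg (by simpa using hn)]

theorem normalize_eq_of_mk_eq {x y : PreFragStar σ B H}
    (h : (Quot.mk _ x : FragStar σ B H) = Quot.mk _ y) :
    normalize hgood x = normalize hgood y := by
  refine congrArg (Quot.lift (r := FragStarGlue σ B H) (normalize hgood) ?_) h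
  rintro _ _ ⟨X, e, t, b, h, hb, hh⟩
  rw [normalize_root hgood e hh]
  simp only [normalize, ← hb]

end

/-- The relation of base vertices. -/
def base (σ : Setoid (Fin r)) (B : Type w) [(fragLanguage L σ).Structure B]
    (H : Gadget.{u, v, w'} L r) (b : B) (m : FragStar σ B H) : Prop :=
  ∃ hb : ¬ IsAuxiliary L σ b, m = Quot.mk _ (Sum.inl ⟨b, hb⟩)

/-- The relation of vertices in copies. -/
def cop (σ : Setoid (Fin r)) (B : Type w) [(fragLanguage L σ).Structure B]
    (H : Gadget.{u, v, w'} L r) (X : Option (Quotient σ)) (e : EdgeTuple σ B X) (h : H.V)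
    (m : FragStar σ B H) : Prop :=
  ∃ (he : e ∈ subedges L σ B X) (hh : h ∈ H.piece σ X),
    m = Quot.mk _ (Sum.inr ⟨X, ⟨e, he⟩, ⟨h, hh⟩⟩)

/-- `hgood` ensures that every root in a copy is glued to a surviving base vertex. `hne` serves
nullary symbols, whose edges in a copy over one class must be available over every class. -/
theorem isDecomposition [L.IsRelational] (T : Set (Σ n, L.Relations n))
    (hsep : ∀ i j, (gaifmanGraph L H.V).Reachable (H.root i) (H.root j) → σ i j)
    (hgood : ∀ X, ∀ e ∈ subedges L σ B X, ∀ t : Fin (classOf σ X).card,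
      ¬ IsAuxiliary L σ (e t.castSucc))
    (hne : ∀ X Y, (subedges L σ B X).Nonempty → (subedges L σ B Y).Nonempty) :
    IsDecomposition T H.root (H.piece σ) (base σ B H) (cop σ B H) := by
  have hl := isPieceLabelling (σ := σ) (H := H) T hsep
  have glue : ∀ {X} (e : subedges L σ B X) (h : H.piece σ X) (t : Fin (classOf σ X).card),
      h.1 = H.root (classEnum σ X t) → (Quot.mk _ (Sum.inr ⟨X, e, h⟩) : FragStar σ B H) =
        Quot.mk _ (Sum.inl ⟨e.1 t.castSucc, hgood X e.1 e.2 t⟩) := fun e h t ht =>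
    (Quot.sound (FragStarGlue.glue _ e t ⟨_, hgood _ e.1 e.2 t⟩ h rfl ht)).symm
  have inr_inj : ∀ {X X'} {e : subedges L σ B X} {e' : subedges L σ B X'} {h : H.piece σ X}
      {h' : H.piece σ X'}, (Quot.mk _ (Sum.inr ⟨X, e, h⟩) : FragStar σ B H) =
        Quot.mk _ (Sum.inr ⟨X', e', h'⟩) → (∀ i, h.1 ≠ H.root i) →
      (⟨X, e, h⟩ : Σ X, subedges L σ B X × H.piece σ X) = ⟨X', e', h'⟩ := by
    intro X X' e e' h h' heq hn
    have := normalize_eq_of_mk_eq hgood heq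
    rw [normalize_of_ne hgood e fun t => hn _] at this
    by_cases hr : ∃ t, h'.1 = H.root (classEnum σ X' t)
    · obtain ⟨t, ht⟩ := hr
      rw [normalize_root hgood e' ht] at this
      exact (Sum.inr_ne_inl this).elim
    · rw [normalize_of_ne hgood e' (not_exists.1 hr)] at this
      exact Sum.inr_injective this
  refine
    { cover := ?_
      not_aux := fun ⟨h, _⟩ => h
      exists_base := fun h => ⟨_, h, rfl⟩
      base_left := ?_
      base_right := ?_
      edge_mem := fun ⟨h, _, _⟩ => h
      lab_of_cop := fun ⟨_, h, _⟩ => h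
      exists_cop := fun he hh => ⟨_, he, hh, rfl⟩
      cop_left := ?_
      edge_inj := ?_
      vertex_inj := ?_
      base_of_cop := ?_
      root_of_base := ?_
      rel_base := ?_
      rel_cop := ?_
      rel_cases := ?_ }
  · rintro ⟨b | ⟨X, e, h⟩⟩
    · exact Or.inl ⟨b.1, b.2, rfl⟩
    · by_cases hr : ∃ i, h.1 = H.root i
      · obtain ⟨i, hi⟩ := hr
        obtain rfl := hl.unique h.2 (hi ▸ hl.root i)
        obtain ⟨t, ht⟩ := exists_classEnum_eq σ i
        exact Or.inl ⟨_, _, glue e h t (by rw [hi, ht])⟩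
      · refine Or.inr ⟨h.1, not_exists.1 hr, fun X' hX' => ?_⟩
        obtain rfl := hl.unique h.2 hX'
        exact ⟨e.1, e.2, h.2, rfl⟩
  · rintro _ _ _ ⟨_, rfl⟩ ⟨_, rfl⟩
    rfl
  · rintro _ _ _ ⟨_, rfl⟩ ⟨_, h⟩
    exact congrArg Subtype.val (Sum.inl_injective (normalize_eq_of_mk_eq hgood h))
  · rintro X _ _ _ _ ⟨_, _, rfl⟩ ⟨_, _, rfl⟩
    rfl
  · rintro X _ _ _ _ _ ⟨_, _, rfl⟩ ⟨_, _, h⟩ hn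
    cases inr_inj h hn
    rfl
  · rintro X X' _ _ _ _ _ ⟨_, _, rfl⟩ ⟨_, _, h⟩ hn
    cases inr_inj h hn
    rfl
  · rintro X e t _ ⟨he, hh, rfl⟩
    exact ⟨_, glue ⟨e, he⟩ ⟨_, hh⟩ t rfl⟩
  · rintro X e h b _ ⟨hb, rfl⟩ ⟨he, hh, heq⟩
    have := normalize_eq_of_mk_eq hgood heq
    by_cases hr : ∃ t, h = H.root (classEnum σ X t)
    · obtain ⟨t, ht⟩ := hr
      rw [normalize_root hgood _ ht] at this
      exact ⟨t, ht, (congrArg Subtype.val (Sum.inl_injective this)).symm⟩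
    · rw [normalize_of_ne hgood _ (not_exists.1 hr)] at this
      exact (Sum.inl_ne_inr this).elim
  · rintro s S - b x hR hx
    choose hb hx using hx
    exact Or.inl ⟨fun i => ⟨b i, hb i⟩, hR, funext hx⟩
  · rintro s S - X e h x hR he hx
    choose _ hh hx using hx
    exact Or.inr ⟨X, ⟨e, he⟩, fun i => ⟨h i, hh i⟩, hR, funext hx⟩
  · rintro s S - x (⟨a, ha, rfl⟩ | ⟨X, e, h, hR, rfl⟩)
    · exact Or.inl ⟨_, ha, fun i => ⟨(a i).2, rfl⟩⟩
    · refine Or.inr ⟨fun i => (h i).1, hR, fun X' hX' => ?_⟩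
      -- A nullary edge fits every label, so its subedge has to be moved to the class `X'`.
      rcases isEmpty_or_nonempty (Fin s) with hs | ⟨⟨i⟩⟩
      · obtain ⟨e', he'⟩ := hne X X' ⟨e.1, e.2⟩
        exact ⟨e', he', isEmptyElim⟩
      · obtain rfl := hl.unique (h i).2 (hX' i)
        exact ⟨e.1, e.2, fun i => ⟨e.2, (h i).2, rfl⟩⟩

end FragStar

/-! ### Elementary limits -/

section Limits

variable {L : FirstOrder.Language.{u, v}}

theorem tendsto_stonePairing_iff {φ : L.Sentence} {M : ℕ → Type w} [∀ n, L.Structure (M n)]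
    {N : Type w'} [L.Structure N] :
    Tendsto (fun n => stonePairing φ (M n)) atTop (𝓝 (stonePairing φ N)) ↔
      ∀ᶠ n in atTop, (M n ⊨ φ ↔ N ⊨ φ) := by
  constructor
  · intro h
    by_cases hN : N ⊨ φ
    · rw [show stonePairing φ N = 1 from if_pos hN] at h
      filter_upwards [h.eventually (lt_mem_nhds zero_lt_one)] with n hn
      refine iff_of_true (by_contra fun hM => ?_) hN
      rw [stonePairing, if_neg hM] at hn
      exact lt_irrefl _ hn
    · rw [show stonePairing φ N = 0 from if_neg hN] at h
      filter_upwards [h.eventually (gt_mem_nhds zero_lt_one)] with n hn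
      refine iff_of_false (fun hM => ?_) hN
      rw [stonePairing, if_pos hM] at hn
      exact lt_irrefl _ hn
  · intro h
    refine tendsto_const_nhds.congr' ?_
    filter_upwards [h] with n hn
    simp only [stonePairing]
    split_ifs <;> tauto

theorem ElementarilyConvergent.eventually_or {M : ℕ → Type w} [∀ n, L.Structure (M n)]
    (h : ElementarilyConvergent L M) (φ : L.Sentence) :
    (∀ᶠ n in atTop, M n ⊨ φ) ∨ ∀ᶠ n in atTop, ¬ M n ⊨ φ := by
  obtain ⟨l, hl⟩ := h φ
  rcases lt_or_ge l 1 with h1 | h1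
  · refine Or.inr ?_
    filter_upwards [hl.eventually (gt_mem_nhds h1)] with n hn hM
    rw [stonePairing, if_pos hM] at hn
    exact lt_irrefl _ hn
  · refine Or.inl ?_
    filter_upwards [hl.eventually (lt_mem_nhds (zero_lt_one.trans_le h1))] with n hn
    by_contra hM
    rw [stonePairing, if_neg hM] at hn
    exact lt_irrefl _ hn

theorem IsElementaryLimit.eventually_iff {M : ℕ → Type w} [∀ n, L.Structure (M n)]
    {N : Type w'} [L.Structure N] (h : IsElementaryLimit L M N) (φ : L.Sentence) :
    ∀ᶠ n in atTop, (M n ⊨ φ ↔ N ⊨ φ) :=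
  tendsto_stonePairing_iff.1 (h φ)

theorem ElementarilyConvergent.exists_uniformlyNonempty {M : ℕ → Type w} [∀ n, L.Structure (M n)]
    (h : ElementarilyConvergent L M) : ∃ k, UniformlyNonempty fun n => M (n + k) := by
  have key : ∀ n, M n ⊨ ((⊤ : L.BoundedFormula Empty 1).ex : L.Sentence) ↔ Nonempty (M n) := by
    intro n
    simp [Sentence.Realize, Formula.Realize, BoundedFormula.realize_ex,
      BoundedFormula.realize_top, exists_true_iff_nonempty]
  have h1 := h.eventually_or (⊤ : L.BoundedFormula Empty 1).ex
  simp only [key, eventually_atTop] at h1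
  rcases h1 with ⟨k, hk⟩ | ⟨k, hk⟩
  · exact ⟨k, ⟨fun m n _ => hk (n + k) (Nat.le_add_left _ _)⟩⟩
  · exact ⟨k, ⟨fun m n hm => (hk (m + k) (Nat.le_add_left _ _) hm).elim⟩⟩

theorem ElementarilyConvergent.eventually_iff_hyperfilter {M : ℕ → Type w} [∀ n, L.Structure (M n)]
    (h : ElementarilyConvergent L M) (k : ℕ) (φ : L.Sentence) :
    ∀ᶠ n in atTop, (M n ⊨ φ ↔ ∀ᶠ m in (hyperfilter ℕ : Filter ℕ), M (m + k) ⊨ φ) := by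
  have hle : ∀ {p : ℕ → Prop}, (∀ᶠ n in atTop, p n) →
      ∀ᶠ m in (hyperfilter ℕ : Filter ℕ), p (m + k) := fun hp =>
    Nat.hyperfilter_le_atTop ((tendsto_add_atTop_nat k).eventually hp)
  rcases h.eventually_or φ with h1 | h1
  · exact h1.mono fun n hn => iff_of_true hn (hle h1)
  · exact h1.mono fun n hn => iff_of_false hn (Ultrafilter.eventually_not.1 (hle h1))

theorem UProd.realize_sentence_iff [L.IsRelational] {U : Ultrafilter ℕ} {M : ℕ → Type w}
    [∀ n, L.Structure (M n)] [UniformlyNonempty M] (φ : L.Sentence) {v : Empty → UProd U M}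
    {x : Fin 0 → UProd U M} : BoundedFormula.Realize φ v x ↔ ∀ᶠ n in U, M n ⊨ φ := by
  rw [Subsingleton.elim v default, UProd.realize_iff]
  refine eventually_congr (Eventually.of_forall fun n => ?_)
  rw [Sentence.Realize, Formula.Realize]
  exact iff_of_eq (congrArg _ (Subsingleton.elim _ _))

/-- Elementarily convergent sequences have elementary limits. -/
theorem ElementarilyConvergent.exists_limit [L.IsRelational] {M : ℕ → Type w}
    [∀ n, L.Structure (M n)] (h : ElementarilyConvergent L M) :
    ∃ (N : Type w) (_ : L.Structure N), IsElementaryLimit L M N := by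
  obtain ⟨k, hk⟩ := h.exists_uniformlyNonempty
  refine ⟨UProd (hyperfilter ℕ) fun n => M (n + k), inferInstance, fun φ => ?_⟩
  rw [tendsto_stonePairing_iff]
  filter_upwards [h.eventually_iff_hyperfilter k φ] with n hn
  rw [hn]
  exact (UProd.realize_sentence_iff (M := fun n => M (n + k)) φ).symm

theorem Gadget.realize_iff_equivSentence_symm {r : ℕ} (G : Gadget.{u, v, w} L r)
    (φ : L[[Fin r]].Sentence) :
    G.V ⊨ φ ↔ (Formula.equivSentence.symm φ).Realize G.root :=
  (Formula.realize_equivSentence_symm_con G.V φ).symm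

/-- Łoś's theorem above is for relational languages, so sentences with constants are read as
`L`-formulas evaluated at the roots of the ultraproduct of a tail. -/
theorem exists_limit_gadget [L.IsRelational] {r : ℕ} {G : ℕ → Gadget.{u, v, w} L r}
    (h : ElementarilyConvergent (L[[Fin r]]) fun n => (G n).V) :
    ∃ H : Gadget.{u, v, w} L r, IsElementaryLimit (L[[Fin r]]) (fun n => (G n).V) H.V := by
  obtain ⟨k, hk⟩ := h.exists_uniformlyNonempty
  obtain ⟨H, hH⟩ : ∃ H : Gadget.{u, v, w} L r, ∀ ψ : L.BoundedFormula Empty r,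
      ψ.Realize default H.root ↔
        ∀ᶠ m in (hyperfilter ℕ : Filter ℕ), ψ.Realize default (G (m + k)).root := by
    refine ⟨{
      V := UProd (hyperfilter ℕ) fun n => (G (n + k)).V
      root := UProd.root fun n => (G (n + k)).root
      root_injective := ?_ }, fun ψ => ?_⟩
    · intro i j hij
      obtain ⟨n, h1, h2⟩ := ((UProd.eq_iff.1 hij).and
        (UProd.out_root fun n => (G (n + k)).root)).exists
      rw [h2, h2] at h1
      exact (G (n + k)).root_injective h1
    · refine (UProd.realize_iff (M := fun n => (G (n + k)).V) ψ _).trans ?_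
      refine eventually_congr ((UProd.out_root fun n => (G (n + k)).root).mono fun m hm => ?_)
      exact iff_of_eq (congrArg _ (funext hm))
  refine ⟨H, fun φ => ?_⟩
  rw [tendsto_stonePairing_iff]
  filter_upwards [h.eventually_iff_hyperfilter k φ] with n hn
  rw [hn, H.realize_iff_equivSentence_symm]
  simp only [Gadget.realize_iff_equivSentence_symm]
  have hr : ∀ G : Gadget.{u, v, w} L r, BoundedFormula.Realize
      (BoundedFormula.relabel (Sum.inr : Fin r → Empty ⊕ Fin r) (Formula.equivSentence.symm φ))
        default G.root ↔ (Formula.equivSentence.symm φ).Realize G.root := fun G =>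
    Formula.realize_relabel_sumInr _
  refine Iff.trans ?_ ((hH _).symm.trans (hr H))
  exact eventually_congr (Eventually.of_forall fun m => (hr (G (m + k))).symm)

theorem Gadget.realize_equivSentence_toFormula {r : ℕ} (G : Gadget.{u, v, w} L r)
    (ψ : L.BoundedFormula Empty r) :
    G.V ⊨ Formula.equivSentence (ψ.toFormula.relabel (Sum.elim Empty.elim id)) ↔
      ψ.Realize default G.root := by
  rw [Gadget.realize_iff_equivSentence_symm, Equiv.symm_apply_apply, Formula.realize_relabel,
    BoundedFormula.realize_toFormula]
  exact iff_of_eq (congrArg₂ _ (Subsingleton.elim _ _) rfl)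

theorem IsElementaryLimit.realize_root_iff {r : ℕ} {G : ℕ → Gadget.{u, v, w} L r}
    {H : Gadget.{u, v, w'} L r} (h : IsElementaryLimit (L[[Fin r]]) (fun n => (G n).V) H.V)
    (ψ : L.BoundedFormula Empty r) :
    ∀ᶠ n in atTop, (ψ.Realize default (G n).root ↔ ψ.Realize default H.root) := by
  filter_upwards [h.eventually_iff (Formula.equivSentence
    (ψ.toFormula.relabel (Sum.elim Empty.elim id)))] with n hn
  rwa [Gadget.realize_equivSentence_toFormula, Gadget.realize_equivSentence_toFormula] at hn

end Limits

/-! ### The main theorem -/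

theorem IsForthSystem.forth_finite {L : FirstOrder.Language.{u, v}} {M : Type w} {N : Type w'}
    [L.Structure M] [L.Structure N] {T : Set (Σ n, L.Relations n)} {𝓕 : Set (Set (M × N))}
    (h : IsForthSystem T 𝓕) {F : Set (M × N)} (hF : F ∈ 𝓕) {ι : Type} [Finite ι] (x : ι → M) :
    ∃ F' ∈ 𝓕, F ⊆ F' ∧ ∃ y : ι → N, ∀ i, (x i, y i) ∈ F' := by
  obtain ⟨F', hF', hsub, y, hy⟩ := h.forth_tuple hF (x ∘ (Finite.equivFin ι).symm)
  exact ⟨F', hF', hsub, y ∘ Finite.equivFin ι, fun i => by simpa using hy (Finite.equivFin ι i)⟩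

/-- Finitely many subedges have finitely many vertices, which the game answers all at once. -/
theorem IsBackForthSystem.hasEdges {L : FirstOrder.Language.{u, v}} {r : ℕ} {σ : Setoid (Fin r)}
    {T : Set (Σ n, L.Relations n)} {B₁ : Type w} {B₂ : Type w'} [(fragLanguage L σ).Structure B₁]
    [(fragLanguage L σ).Structure B₂] {𝓑 : Set (Set (B₁ × B₂))}
    (h : IsBackForthSystem (fragSymbolSet σ T) 𝓑) (hne : 𝓑.Nonempty) {X : Option (Quotient σ)}
    {m : ℕ} (hm : HasEdges L σ B₁ X m) : HasEdges L σ B₂ X m := by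
  obtain ⟨F, hF⟩ := hne
  obtain ⟨g, hg, hmem⟩ := hm
  obtain ⟨F', hF', -, y, hy⟩ := h.left.forth_finite hF
    fun p : Fin m × Fin ((classOf σ X).card + 1) => g p.1 p.2
  refine ⟨fun k t => y (k, t), fun k k' hk => hg (funext fun t => ?_), fun k => ?_⟩
  · exact (h.eq_iff hF' (hy (k, t)) (hy (k', t))).2 (congrFun hk t)
  · exact h.left.rel F' hF' (Sum.inr (FragRel.sub X)) (Or.inr ⟨X, rfl⟩) (g k) _
      (fun t => hy (k, t)) (hmem k)

/-- In each coordinate the subedges of any class correspond bijectively to the edges of the base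
structure; the bijections between classes are applied coordinatewise. -/
theorem hasEdges_uprod_fragmented {L : FirstOrder.Language.{u, v}} [L.IsRelational] {r : ℕ}
    {σ : Setoid (Fin r)} {U : Ultrafilter ℕ} {A : ℕ → BaseStructure.{u, v, w} L r}
    [UniformlyNonempty fun n => Fragmented (A n) σ] {X : Option (Quotient σ)} {m : ℕ}
    (h : HasEdges L σ (UProd U fun n => Fragmented (A n) σ) X m) (Y : Option (Quotient σ)) :
    HasEdges L σ (UProd U fun n => Fragmented (A n) σ) Y m := by
  obtain ⟨g, hg, hmem⟩ := h
  have : ∀ k, ∃ e : EdgeTuple σ (UProd U fun n => Fragmented (A n) σ) Y, ∀ᶠ n in U, ∃ e₀,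
      (fun t => (g k t).out n) = Fragmented.subedge X e₀ ∧
        (fun t => (e t).out n) = Fragmented.subedge Y e₀ := by
    intro k
    refine UProd.exists_tuple_of_eventually (Q := fun n e => ∃ e₀,
      (fun t => (g k t).out n) = Fragmented.subedge X e₀ ∧ e = Fragmented.subedge Y e₀) ?_
    filter_upwards [UProd.mem_subedges_iff.1 (hmem k)] with n hn
    obtain ⟨e₀, he₀⟩ := Fragmented.mem_subedges_iff.1 hn
    exact ⟨_, e₀, he₀, rfl⟩
  choose e he using this
  refine ⟨e, fun k k' hk => hg (funext fun t => UProd.eq_iff.2 ?_), fun k => ?_⟩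
  · filter_upwards [he k, he k'] with n ⟨e₀, h1, h2⟩ ⟨e₁, h3, h4⟩
    rw [hk] at h2
    obtain rfl := Fragmented.subedge_injective Y (h2.symm.trans h4)
    exact congrFun (h1.trans h3.symm) t
  · exact UProd.mem_subedges_iff.2 ((he k).mono fun n ⟨e₀, _, h2⟩ =>
      Fragmented.mem_subedges_iff.2 ⟨e₀, h2⟩)

/-- The property `Q` will be nonemptiness, made constant along the sequence so that the
ultraproducts behave well. -/
theorem exists_subsequence {P Q : ℕ → Prop} (h : ∃ᶠ n in atTop, P n) :
    ∃ g : ℕ → ℕ, StrictMono g ∧ (∀ n, P (g n)) ∧ ∀ m n, Q (g m) → Q (g n) := by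
  have : (∃ᶠ n in atTop, P n ∧ Q n) ∨ ∃ᶠ n in atTop, P n ∧ ¬ Q n := by
    rw [← frequently_or_distrib]
    exact h.mono fun n hn => by tauto
  rcases this with h | h
  · obtain ⟨g, hg, hp⟩ := extraction_of_frequently_atTop h
    exact ⟨g, hg, fun n => (hp n).1, fun m n _ => (hp n).2⟩
  · obtain ⟨g, hg, hp⟩ := extraction_of_frequently_atTop h
    exact ⟨g, hg, fun n => (hp n).1, fun m n hm => ((hp m).2 hm).elim⟩

section Main

variable {L : FirstOrder.Language.{u, v}} [L.IsRelational] {r : ℕ}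

/-- Roots in the same component of an elementary limit have bounded distance. -/
theorem gadgetEq_of_reachable {G : ℕ → Gadget.{u, v, w} L r} {H : Gadget.{u, v, w'} L r}
    (hH : ∀ ψ : L.BoundedFormula Empty r, ∀ᶠ n in atTop,
      ψ.Realize default (G n).root ↔ ψ.Realize default H.root) {i j : Fin r}
    (hij : (gaifmanGraph L H.V).Reachable (H.root i) (H.root j)) : gadgetEq G i j := by
  obtain ⟨T, hT, d, hd⟩ := exists_finite_walkOn hij
  suffices h : ∀ᶠ n in atTop, WalkOn T d ((G n).root i) ((G n).root j) from
    ⟨d, h.mono fun n hn => hn.edist_le⟩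
  by_contra hc
  rw [not_eventually] at hc
  -- Along a subsequence without such walks, the ultraproduct of the gadgets would inherit the walk
  -- of the ultrapower of `H`.
  obtain ⟨g, hg, hn⟩ := extraction_of_frequently_atTop hc
  have : UniformlyNonempty fun n => (G (g n)).V := ⟨fun _ n _ => ⟨(G (g n)).root i⟩⟩
  obtain ⟨𝓕, h𝓕, ⟨F, hF⟩, hroot⟩ := UProd.exists_isBackForthSystem (U := hyperfilter ℕ)
    hT.countable Nat.hyperfilter_le_atTop (M := fun n => (G (g n)).V) (N := fun _ => H.V)
    (fun n => (G (g n)).root) (fun _ => H.root)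
    fun ψ => Nat.hyperfilter_le_atTop (hg.tendsto_atTop.eventually (hH ψ))
  have hw : ∀ᶠ n in (hyperfilter ℕ : Filter ℕ), WalkOn T d
      ((UProd.root (fun n => (G (g n)).root) i : UProd _ fun n => (G (g n)).V).out n)
      ((UProd.root (fun n => (G (g n)).root) j : UProd _ fun n => (G (g n)).V).out n) :=
    UProd.walkOn_eventually (h𝓕.right.walkOn (swap_mem_swapFamily hF) (hroot F hF i)
      (hroot F hF j) (UProd.walkOn_of_const hd))
  obtain ⟨n, h1, h2⟩ := (hw.and (UProd.out_root fun n => (G (g n)).root)).exists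
  rw [h2, h2] at h1
  exact hn n h1

/-- The hypotheses of the composed game are verified. Properties of the `A_n^σ` that `B` must share
are transferred through the base game instead of being written as sentences. -/
theorem exists_isBackForthSystem_uprod {A : ℕ → BaseStructure.{u, v, w} L r}
    {G : ℕ → Gadget.{u, v, w'} L r} {σ : Setoid (Fin r)} {B : Type w₁}
    [(fragLanguage L σ).Structure B] {H : Gadget.{u, v, w₂} L r}
    [UniformlyNonempty fun n => Fragmented (A n) σ] [UniformlyNonempty fun n => (G n).V]
    [UniformlyNonempty fun n => GadgetStar (A n) (G n)]
    (hB : ∀ φ : (fragLanguage L σ).Sentence, ∀ᶠ n in atTop, (Fragmented (A n) σ ⊨ φ ↔ B ⊨ φ))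
    (hH : ∀ ψ : L.BoundedFormula Empty r, ∀ᶠ n in atTop,
      ψ.Realize default (G n).root ↔ ψ.Realize default H.root)
    (hsep : ∀ i j, (gaifmanGraph L H.V).Reachable (H.root i) (H.root j) → σ i j)
    {T : Set (Σ n, L.Relations n)} (hT : T.Finite) :
    ∃ 𝓕 : Set (Set (UProd (hyperfilter ℕ) (fun n => GadgetStar (A n) (G n)) ×
        UProd (hyperfilter ℕ) fun _ => FragStar σ B H)),
      IsBackForthSystem T 𝓕 ∧ 𝓕.Nonempty := by
  have hU := Nat.hyperfilter_le_atTop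
  obtain ⟨𝓑, h𝓑, h𝓑ne, -⟩ := UProd.exists_isBackForthSystem (L := fragLanguage L σ)
    (finite_fragSymbolSet σ hT).countable hU (M := fun n => Fragmented (A n) σ) (N := fun _ => B)
    (k := 0) (fun _ => default) (fun _ => default) fun ψ => hU (hB ψ)
  obtain ⟨𝓗, h𝓗, h𝓗ne, hroot⟩ := UProd.exists_isBackForthSystem hT.countable hU
    (M := fun n => (G n).V) (N := fun _ => H.V) (fun n => (G n).root) (fun _ => H.root)
    fun ψ => hU (hH ψ)
  have h𝓑ne' : (swapFamily 𝓑).Nonempty := h𝓑ne.imp' _ fun _ hF => swap_mem_swapFamily hF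
  have hparts : PartsBackForth σ T 𝓑 𝓗 (UProd.root fun n => (G n).root)
      (UProd.root fun _ => H.root) :=
    { base := h𝓑
      gadget := h𝓗
      root_mem := hroot
      hasEdges₁ := fun X Y m h => ⟨hasEdges_uprod_fragmented h Y,
        h𝓑.hasEdges h𝓑ne (hasEdges_uprod_fragmented h Y)⟩
      hasEdges₂ := fun X Y m h =>
        have h' := hasEdges_uprod_fragmented (h𝓑.symm.hasEdges h𝓑ne' h) Y
        ⟨h𝓑.hasEdges h𝓑ne h', h'⟩ }
  have hdiag : ∀ X, ∀ e ∈ subedges L σ B X, (fun t => UProd.mk fun _ => e t) ∈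
      subedges L σ (UProd (hyperfilter ℕ) fun _ => B) X := by
    intro X e he
    refine UProd.mem_subedges_iff.2 ?_
    filter_upwards [eventually_all.2 fun t => UProd.out_mk (U := hyperfilter ℕ)
      (M := fun _ => B) fun _ => e t] with n hn
    simpa only [hn] using he
  -- The roles of vertices in a subedge are kept apart in every `A_n^σ`, hence in the ultraproduct,
  -- hence in `B`.
  have hgood : ∀ X, ∀ e ∈ subedges L σ B X, ∀ t : Fin (classOf σ X).card,
      ¬ IsAuxiliary L σ (e t.castSucc) := by
    intro X e he t
    obtain ⟨F, hF⟩ := h𝓑ne'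
    obtain ⟨F', hF', -, e', he'⟩ := h𝓑.right.forth_tuple hF fun t => UProd.mk fun _ => e t
    have h1 := hparts.symm.map_subedges hF' he' (hdiag X e he)
    have h2 : ¬ IsAuxiliary L σ (e' t.castSucc) := by
      refine UProd.not_isAuxiliary_iff.2 ((UProd.mem_subedges_iff.1 h1).mono fun n hn => ?_)
      obtain ⟨e₀, he₀⟩ := Fragmented.mem_subedges_iff.1 hn
      exact Fragmented.not_isAuxiliary_iff.2 ⟨_, (congrFun he₀ t.castSucc).trans
        (Fragmented.subedge_castSucc X e₀ t)⟩
    have h3 : ∀ᶠ n in (hyperfilter ℕ : Filter ℕ), ¬ IsAuxiliary L σ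
        ((UProd.mk fun _ => e t.castSucc : UProd (hyperfilter ℕ) fun _ => B).out n) :=
      UProd.not_isAuxiliary_iff.1 (hparts.not_aux (F := Prod.swap ⁻¹' F') hF' (he' t.castSucc) h2)
    obtain ⟨n, h4, h5⟩ := (h3.and (UProd.out_mk fun _ => e t.castSucc)).exists
    rwa [h5] at h4
  have hne : ∀ X Y, (subedges L σ B X).Nonempty → (subedges L σ B Y).Nonempty := by
    rintro X Y ⟨e, he⟩
    have h1 : HasEdges L σ (UProd (hyperfilter ℕ) fun _ => B) X 1 :=
      ⟨fun _ t => UProd.mk fun _ => e t, Function.injective_of_subsingleton _,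
        fun _ => hdiag X e he⟩
    obtain ⟨g, -, hg⟩ := (hparts.hasEdges₂ X Y 1 h1).1
    obtain ⟨n, hn⟩ := (UProd.mem_subedges_iff.1 (hg 0)).exists
    exact ⟨_, hn⟩
  have hl₁ : IsPieceLabelling (σ := σ) T
      (UProd.root fun n => (G n).root : Fin r → UProd (hyperfilter ℕ) fun n => (G n).V)
      (componentLabel T (UProd.root fun n => (G n).root)) := by
    -- A `T`-walk between roots of the ultraproduct has a fixed length, so it reappears in a
    -- coordinate of the ultrapower of `H`, that is, in `H` itself.
    refine isPieceLabelling_componentLabel fun i j ⟨d, hd⟩ => hsep i j ?_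
    obtain ⟨F, hF⟩ := h𝓗ne
    have h1 := UProd.walkOn_eventually (h𝓗.left.walkOn hF (hroot F hF i) (hroot F hF j) hd)
    obtain ⟨n, h2, h3⟩ := (h1.and (UProd.out_root fun _ => H.root)).exists
    have h4 := h3 i
    have h5 := h3 j
    simp only [UProd.root] at h4 h5
    rw [h4, h5] at h2
    exact h2.reachable
  have hl₂ := UProd.isPieceLabelling (U := hyperfilter ℕ)
    fun _ : ℕ => FragStar.isPieceLabelling (H := H) T hsep
  -- Only in the ultraproduct do the pieces of a copy separate, so only now can the coarse labels be
  -- restricted to `componentLabel`.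
  have D₁ := (UProd.isDecomposition (U := hyperfilter ℕ) fun n =>
    GadgetStar.isDecomposition T σ (A n) (G n)).relabel
      fun {_ _} h => UProd.lab_rootLabel (hl₁.rootLabel h)
  have D₂ := UProd.isDecomposition (U := hyperfilter ℕ) fun _ : ℕ =>
    FragStar.isDecomposition (H := H) T hsep hgood hne
  exact ⟨_, hparts.isBackForthSystem D₁ D₂ hl₁ hl₂,
    PartsBackForth.positionFamily_nonempty h𝓑ne h𝓗ne⟩

/-- The equivalence `σ` enters only through the separation `hsep` of its classes in `H`. -/
theorem isElementaryLimit_gadgetStar {A : ℕ → BaseStructure.{u, v, w} L r}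
    {G : ℕ → Gadget.{u, v, w'} L r} {σ : Setoid (Fin r)} (hσ : σ = gadgetEq G) {B : Type w₁}
    [(fragLanguage L σ).Structure B] {H : Gadget.{u, v, w₂} L r}
    (hB : IsElementaryLimit (fragLanguage L σ) (fun n => Fragmented (A n) σ) B)
    (hH : IsElementaryLimit (L[[Fin r]]) (fun n => (G n).V) H.V) :
    IsElementaryLimit L (fun n => GadgetStar (A n) (G n)) (FragStar σ B H) := by
  have hsep : ∀ i j, (gaifmanGraph L H.V).Reachable (H.root i) (H.root j) → σ i j := by
    intro i j hij
    rw [hσ]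
    exact gadgetEq_of_reachable hH.realize_root_iff hij
  intro φ
  rw [tendsto_stonePairing_iff]
  by_contra hc
  rw [not_eventually] at hc
  -- Three successive subsequences of the indices where `φ` disagrees, one for each sequence of
  -- structures whose emptiness must become constant.
  obtain ⟨g₁, hg₁, hP, h₁⟩ := exists_subsequence (Q := fun n => Nonempty (Fragmented (A n) σ)) hc
  obtain ⟨g₂, hg₂, -, h₂⟩ := exists_subsequence (P := fun _ => True)
    (Q := fun n => Nonempty (G (g₁ n)).V) (Eventually.of_forall fun _ => trivial).frequently
  obtain ⟨g₃, hg₃, -, h₃⟩ := exists_subsequence (P := fun _ => True)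
    (Q := fun n => Nonempty (GadgetStar (A (g₁ (g₂ n))) (G (g₁ (g₂ n)))))
    (Eventually.of_forall fun _ => trivial).frequently
  let g := fun n => g₁ (g₂ (g₃ n))
  have hg : Tendsto g atTop atTop := (hg₁.comp (hg₂.comp hg₃)).tendsto_atTop
  have : UniformlyNonempty fun n => Fragmented (A (g n)) σ := ⟨fun m n => h₁ _ _⟩
  have : UniformlyNonempty fun n => (G (g n)).V := ⟨fun m n => h₂ _ _⟩
  have : UniformlyNonempty fun n => GadgetStar (A (g n)) (G (g n)) := ⟨h₃⟩
  obtain ⟨T, hT, hφ⟩ := exists_finite_realize_iff.{u, v, max w w', max w₁ w₂} φ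
  obtain ⟨𝓕, h𝓕, F, hF⟩ := exists_isBackForthSystem_uprod (A := fun n => A (g n))
    (G := fun n => G (g n)) (B := B) (H := H) (fun φ => hg.eventually (hB.eventually_iff φ))
    (fun ψ => hg.eventually (hH.realize_root_iff ψ)) hsep hT
  have h := hφ _ _ 𝓕 h𝓕 F hF default default fun i => i.elim0
  rw [UProd.realize_sentence_iff (M := fun n => GadgetStar (A (g n)) (G (g n))),
    UProd.realize_sentence_iff (M := fun _ => FragStar σ B H), eventually_const] at h
  have h4 : ∀ n, ¬ (GadgetStar (A (g n)) (G (g n)) ⊨ φ ↔ FragStar σ B H ⊨ φ) := fun n => hP _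
  by_cases hN : FragStar σ B H ⊨ φ
  · obtain ⟨n, hn⟩ := (h.2 hN).exists
    exact h4 n (iff_of_true hn hN)
  · exact hN (h.1 (Eventually.of_forall fun n => not_not.1 fun hn => h4 n (iff_of_false hn hN)))

end Main

theorem mainTheorem4 {L : FirstOrder.Language.{u, v}} [L.IsRelational] {r : ℕ}
    (A : ℕ → BaseStructure.{u, v, w} L r) (G : ℕ → Gadget.{u, v, w'} L r)
    (hG : ElementarilyConvergent (L[[Fin r]]) (fun n => (G n).V))
    (σ : Setoid (Fin r)) (hσ : σ = gadgetEq G)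
    (hA : ElementarilyConvergent (fragLanguage L σ) (fun n => Fragmented (A n) σ)) :
    ElementarilyConvergent L (fun n => GadgetStar (A n) (G n)) ∧
    ∀ (B : Type w₁) [(fragLanguage L σ).Structure B] (H : Gadget.{u, v, w₂} L r),
      IsElementaryLimit (fragLanguage L σ) (fun n => Fragmented (A n) σ) B →
      IsElementaryLimit (L[[Fin r]]) (fun n => (G n).V) H.V →
      IsElementaryLimit L (fun n => GadgetStar (A n) (G n)) (FragStar σ B H) ∧
      ∀ (C : Type w₃) [L.Structure C],
        IsElementaryLimit L (fun n => GadgetStar (A n) (G n)) C → C ≅[L] FragStar σ B H := by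
  constructor
  -- Convergence follows from the limit formula, applied to limits of the two given sequences that
  -- are built as ultraproducts.
  · obtain ⟨B, _, hB⟩ := hA.exists_limit
    obtain ⟨H, hH⟩ := exists_limit_gadget hG
    exact fun φ => ⟨_, isElementaryLimit_gadgetStar hσ hB hH φ⟩
  · intro B _ H hB hH
    have h := isElementaryLimit_gadgetStar hσ hB hH
    refine ⟨h, fun C _ hC => elementarilyEquivalent_iff.2 fun φ => ?_⟩
    obtain ⟨n, h1, h2⟩ := ((hC.eventually_iff φ).and (h.eventually_iff φ)).exists
    exact h1.symm.trans h2
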